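/- Let $d\ge 0$, let $H$ be a locally compact group with a $\sigma$-finite left Haar measure $\nu$ (for instance any compact group), acting continuously on $\mathbb R^d$ by linear isometries $a\mapsto\rho(a)$, and let $G=\mathbb R^d\rtimes H$ with product $(u,a)(v,b)=(u+\rho(a)v,ab)$ and left Haar measure $d\mu(u,a)=du\,d\nu(a)$. Write $e$ for the identity of $H$. Let $\mathcal H$ be a real Hilbert space. Define bounded operators as follows. * Deformation: for a $C^1$ map $\tau:\mathbb R^d\to\mathbb R^d$ with $\|\nabla\tau\|_\infty:=\sup_u\|\nabla\tau(u)\|\le 1/2$ (operator norm of the Jacobian), $L_\tau x(u,a)=x((\tau(u),e)^{-1}(u,a))=x(u-\tau(u),a)$ on $L^2(G,\mathcal K)$, for any Hilbert space $\mathcal K$. * Pooling: for a filter $h:\mathbb R^d\to\mathbb R$ of class $C^1$ with $h,|\nabla h|\in L^1(\mathbb R^d)$ and a scale $\sigma>0$, put $h_\sigma(v)=\sigma^{-d}h(v/\sigma)$ and $Ax(g)=\int_{\mathbb R^d}x(g\,(v,e))\,h_\sigma(v)\,dv$ on $L^2(G,\mathcal H)$. * Patch extraction: for a patch shape $S=\hat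 S\times\{e\}$, $\hat S\subseteq\mathbb R^d$, carrying a Borel probability measure $\pi$ (for instance normalized Lebesgue measure on $\hat S$), put $Px(g)=(x(g\,(v,e)))_{v\in\hat S}$, an operator $L^2(G,\mathcal H)\to L^2(G,L^2(\hat S,\pi;\mathcal H))$. All norms of operators are operator norms. Then the following hold. (1) Assume in addition that $|v|\,|\nabla h(v)|$ is integrable, and let $\kappa\in\mathbb R$. There is a constant $C_1\ge 0$ depending only on $h$ (hence on $d$) and $\kappa$, such that for all $H,\nu,\rho,\mathcal H$, all $\sigma>0$, all $(\hat S,\pi)$ with $\sup_{c\in\hat S}|c|\le\kappa\sigma$, and all $\tau$ as above, $$\|[PA,L_\tau]\|=\|PA\,L_\tau-L_\tau\,PA\|\le C_1\|\nabla\tau\|_\infty .$$ (2) For all $h,\sigma,H,\nu,\rho,\mathcal H$ and all $\tau$ as above with $\|\tau\|_\infty:=\sup_u|\tau(u)|<\infty$, $$\|L_\tau A-A\|\le\frac{C_2}{\sigma}\|\tau\|_\infty ,\qquad C_2=2^d\,\|\nabla h\|_{L^1(\mathbb R^d)},$$ and if $d\le 4$ the same bound also holds with $C_2=2^2\,\|\nabla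 h\|_{L^1(\mathbb R^d)}$. -/

import Mathlib

open MeasureTheory Filter Topology
open scoped ENNReal NNReal

noncomputable section

set_option linter.unusedSectionVars false

namespace CKN

section Generic

variable {X Y V F F' : Type*} [MeasurableSpace X] [MeasurableSpace Y] [MeasurableSpace V]
  [NormedAddCommGroup F] [NormedSpace ℝ F] [NormedAddCommGroup F'] [NormedSpace ℝ F']

/-- The bounded operator `L²(μ) → L²(μ')` induced by an operator `T` on functions. -/
def l2Op (μ : Measure X) (μ' : Measure Y) (T : (X → F) → (Y → F')) (C : ℝ≥0)
    (hmeas : ∀ x, MemLp x 2 μ → AEStronglyMeasurable (T x) μ')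
    (hbd : ∀ x, MemLp x 2 μ → eLpNorm (T x) 2 μ' ≤ C * eLpNorm x 2 μ)
    (hcongr : ∀ x y, MemLp x 2 μ → x =ᵐ[μ] y → T x =ᵐ[μ'] T y)
    (hadd : ∀ x y, MemLp x 2 μ → MemLp y 2 μ → T (x + y) =ᵐ[μ'] T x + T y)
    (hsmul : ∀ (c : ℝ) x, MemLp x 2 μ → T (c • x) =ᵐ[μ'] c • T x) :
    Lp F 2 μ →L[ℝ] Lp F' 2 μ' :=
  have hmem : ∀ x, MemLp x 2 μ → MemLp (T x) 2 μ' := fun x hx =>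
    ⟨hmeas x hx, (hbd x hx).trans_lt (ENNReal.mul_lt_top ENNReal.coe_lt_top hx.2)⟩
  LinearMap.mkContinuous
    { toFun := fun x => (hmem x (Lp.memLp x)).toLp (T x)
      map_add' := fun x y => by
        rw [← MemLp.toLp_add]
        refine MemLp.toLp_congr _ _ ?_
        exact (hcongr _ _ (Lp.memLp _) (Lp.coeFn_add x y)).trans
          (hadd _ _ (Lp.memLp x) (Lp.memLp y))
      map_smul' := fun c x => by
        rw [RingHom.id_apply, ← MemLp.toLp_const_smul]
        refine MemLp.toLp_congr _ _ ?_
        exact (hcongr _ _ (Lp.memLp _) (Lp.coeFn_smul c x)).trans (hsmul _ _ (Lp.memLp x)) }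
    C (fun x => by
      change ‖(hmem x (Lp.memLp x)).toLp (T x)‖ ≤ _
      rw [Lp.norm_toLp, Lp.norm_def, ← ENNReal.coe_toReal C, ← ENNReal.toReal_mul]
      exact ENNReal.toReal_mono
        (ENNReal.mul_ne_top ENNReal.coe_ne_top (Lp.eLpNorm_ne_top x)) (hbd x (Lp.memLp x)))

/-- The operator `l2Op` acts on classes by the given operator on functions. -/
theorem l2Op_ae {μ : Measure X} {μ' : Measure Y} {T : (X → F) → (Y → F')} {C : ℝ≥0}
    {hmeas hbd hcongr hadd hsmul} (x : Lp F 2 μ) :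
    l2Op μ μ' T C hmeas hbd hcongr hadd hsmul x =ᵐ[μ'] T x :=
  MemLp.coeFn_toLp ⟨hmeas x (Lp.memLp x), (hbd x (Lp.memLp x)).trans_lt
    (ENNReal.mul_lt_top ENNReal.coe_lt_top (Lp.memLp x).2)⟩

theorem eLpNorm_two_sq (μ : Measure X) (f : X → F) :
    eLpNorm f 2 μ ^ 2 = ∫⁻ a, ‖f a‖ₑ ^ 2 ∂μ := by
  have := eLpNorm_nnreal_pow_eq_lintegral (μ := μ) (f := f) (p := 2) (by norm_num)
  simpa using this

theorem le_mul_of_sq_le {a b c : ℝ≥0∞} (h : a ^ 2 ≤ c ^ 2 * b ^ 2) : a ≤ c * b := by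
  rw [← mul_pow] at h
  exact (ENNReal.pow_le_pow_left_iff (by norm_num)).1 h

/-! ### Averaging along a measure preserving family -/

section Family

variable {μ : Measure X} [SFinite μ] {π : Measure V} [SFinite π] {r : X × V → X}

theorem qmp_family (hr : Measurable r) (hp : ∀ v, MeasurePreserving (fun g => r (g, v)) μ μ) :
    Measure.QuasiMeasurePreserving r (μ.prod π) μ :=
  QuasiMeasurePreserving.prod_of_left hr (ae_of_all _ fun v => (hp v).quasiMeasurePreserving)

theorem lintegral_family (hr : Measurable r)
    (hp : ∀ v, MeasurePreserving (fun g => r (g, v)) μ μ) {f : X → ℝ≥0∞} (hf : AEMeasurable f μ)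
    {k : V → ℝ≥0∞} (hk : AEMeasurable k π) :
    ∫⁻ g, ∫⁻ v, k v * f (r (g, v)) ∂π ∂μ = (∫⁻ v, k v ∂π) * ∫⁻ g, f g ∂μ := by
  have hm : AEMeasurable (fun p : X × V => k p.2 * f (r p)) (μ.prod π) :=
    hk.comp_snd.mul (hf.comp_quasiMeasurePreserving (qmp_family hr hp))
  rw [lintegral_lintegral_swap hm, ← lintegral_mul_const'' _ hk]
  refine lintegral_congr fun v => ?_
  have h1 : ∫⁻ g, f (r (g, v)) ∂μ = ∫⁻ g, f g ∂μ := by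
    have := lintegral_map' (g := fun g => r (g, v)) (f := f) (μ := μ)
      (by rw [(hp v).map_eq]; exact hf) (hp v).measurable.aemeasurable
    rw [(hp v).map_eq] at this
    exact this.symm
  have h2 : AEMeasurable (fun g => f (r (g, v))) μ :=
    hf.comp_quasiMeasurePreserving (hp v).quasiMeasurePreserving
  rw [lintegral_const_mul'' _ h2, h1]

theorem sq_lintegral_mul_le {k f : V → ℝ≥0∞} (hk : AEMeasurable k π) (hf : AEMeasurable f π) :
    (∫⁻ v, k v * f v ∂π) ^ 2 ≤ (∫⁻ v, k v ∂π) * ∫⁻ v, k v * f v ^ 2 ∂π := by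
  have h2 : (2 : ℝ).HolderConjugate 2 := by
    rw [Real.holderConjugate_iff]; norm_num
  have := ENNReal.lintegral_mul_le_Lp_mul_Lq π h2 (f := fun v => k v ^ (1 / 2 : ℝ))
    (g := fun v => k v ^ (1 / 2 : ℝ) * f v) (hk.pow_const _) ((hk.pow_const _).mul hf)
  have e1 : ∀ v, k v ^ (1 / 2 : ℝ) * k v ^ (1 / 2 : ℝ) = k v := fun v => by
    rw [← ENNReal.rpow_add_of_nonneg _ _ (by norm_num) (by norm_num)]; norm_num
  have e2 : ∀ v, (k v ^ (1 / 2 : ℝ)) ^ (2 : ℝ) = k v := fun v => by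
    rw [← ENNReal.rpow_mul]; norm_num
  simp only [Pi.mul_apply, ← mul_assoc, e1, ENNReal.mul_rpow_of_nonneg _ _ zero_le_two, e2] at this
  calc _ ≤ ((∫⁻ v, k v ∂π) ^ (1 / 2 : ℝ) * (∫⁻ v, k v * f v ^ (2 : ℝ) ∂π) ^ (1 / 2 : ℝ)) ^ 2 := by
        gcongr
    _ = _ := by
        rw [mul_pow]
        simp only [← ENNReal.rpow_natCast, ← ENNReal.rpow_mul]
        norm_num

theorem avg_lintegral_le (hr : Measurable r)
    (hp : ∀ v, MeasurePreserving (fun g => r (g, v)) μ μ) {k : V → ℝ} (hk : Integrable k π)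
    {x : X → F} (hx : MemLp x 2 μ) :
    ∫⁻ g, (∫⁻ v, ‖k v • x (r (g, v))‖ₑ ∂π) ^ 2 ∂μ
      ≤ (∫⁻ v, ‖k v‖ₑ ∂π) ^ 2 * eLpNorm x 2 μ ^ 2 := by
  have hq := qmp_family (π := π) hr hp
  have hm := (hx.1.comp_quasiMeasurePreserving hq).prodMk_left
  calc _ ≤ ∫⁻ g, (∫⁻ v, ‖k v‖ₑ ∂π) * ∫⁻ v, ‖k v‖ₑ * ‖x (r (g, v))‖ₑ ^ 2 ∂π ∂μ := by
        refine lintegral_mono_ae ?_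
        filter_upwards [hm] with g hg
        simp only [enorm_smul]
        exact sq_lintegral_mul_le hk.1.enorm hg.enorm
    _ = _ := by
        rw [lintegral_const_mul' _ _ hk.2.ne,
          lintegral_family hr hp (f := fun g => ‖x g‖ₑ ^ 2) (hx.1.enorm.pow_const 2) hk.1.enorm,
          eLpNorm_two_sq, ← mul_assoc, ← sq]

theorem avg_integrable (hr : Measurable r)
    (hp : ∀ v, MeasurePreserving (fun g => r (g, v)) μ μ) {k : V → ℝ} (hk : Integrable k π)
    {x : X → F} (hx : MemLp x 2 μ) :
    ∀ᵐ g ∂μ, Integrable (fun v => k v • x (r (g, v))) π := by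
  have hq := qmp_family (π := π) hr hp
  have hm := hk.1.comp_snd (μ := μ) |>.smul (hx.1.comp_quasiMeasurePreserving hq)
  have h1 := (avg_lintegral_le hr hp hk hx).trans_lt
    (ENNReal.mul_lt_top (ENNReal.pow_lt_top hk.2) (ENNReal.pow_lt_top hx.2))
  filter_upwards [ae_lt_top' (hm.enorm.lintegral_prod_right'.pow_const 2) h1.ne, hm.prodMk_left]
    with g hg hg'
  refine ⟨hg', ?_⟩
  simpa [HasFiniteIntegral] using hg

/-- Averaging `x` along the family `r` with weight `k`. -/
def avg (π : Measure V) (r : X × V → X) (k : V → ℝ) (x : X → F) (g : X) : F :=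
  ∫ v, k v • x (r (g, v)) ∂π

theorem avg_aestronglyMeasurable (hr : Measurable r)
    (hp : ∀ v, MeasurePreserving (fun g => r (g, v)) μ μ) {k : V → ℝ} (hk : Integrable k π)
    {x : X → F} (hx : MemLp x 2 μ) : AEStronglyMeasurable (avg π r k x) μ :=
  (hk.1.comp_snd.smul
    (hx.1.comp_quasiMeasurePreserving (qmp_family (π := π) hr hp))).integral_prod_right'

theorem avg_eLpNorm_le (hr : Measurable r)
    (hp : ∀ v, MeasurePreserving (fun g => r (g, v)) μ μ) {k : V → ℝ} (hk : Integrable k π)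
    {x : X → F} (hx : MemLp x 2 μ) :
    eLpNorm (avg π r k x) 2 μ ≤ ((∫⁻ v, ‖k v‖ₑ ∂π).toNNReal : ℝ≥0∞) * eLpNorm x 2 μ := by
  rw [ENNReal.coe_toNNReal hk.2.ne]
  refine le_mul_of_sq_le (le_trans ?_ (avg_lintegral_le hr hp hk hx))
  rw [eLpNorm_two_sq]
  gcongr with g
  exact enorm_integral_le_lintegral_enorm _

theorem avg_congr (hr : Measurable r)
    (hp : ∀ v, MeasurePreserving (fun g => r (g, v)) μ μ) (k : V → ℝ) {x y : X → F}
    (hxy : x =ᵐ[μ] y) : avg π r k x =ᵐ[μ] avg π r k y := by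
  have := Measure.ae_ae_of_ae_prod ((qmp_family (π := π) hr hp).ae_eq_comp hxy)
  filter_upwards [this] with g hg
  refine integral_congr_ae ?_
  filter_upwards [hg] with v hv
  simpa using congrArg (k v • ·) hv

theorem avg_add (hr : Measurable r)
    (hp : ∀ v, MeasurePreserving (fun g => r (g, v)) μ μ) {k : V → ℝ} (hk : Integrable k π)
    {x y : X → F} (hx : MemLp x 2 μ) (hy : MemLp y 2 μ) :
    avg π r k (x + y) =ᵐ[μ] avg π r k x + avg π r k y := by
  filter_upwards [avg_integrable hr hp hk hx, avg_integrable hr hp hk hy] with g h1 h2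
  simp only [avg, Pi.add_apply, smul_add]
  exact integral_add h1 h2

theorem avg_smul (k : V → ℝ) (c : ℝ) (x : X → F) : avg π r k (c • x) = c • avg π r k x := by
  ext g
  simp only [avg, Pi.smul_apply, smul_comm _ c]
  exact integral_smul c _

end Family

/-! ### Slices -/

section Slice

variable {μ : Measure X} [SFinite μ] {π : Measure V} [IsProbabilityMeasure π]

open Classical in
/-- The class in `L²(π, F)` of a function, and `0` if the function is not in `L²`. -/
def toL2 (π : Measure V) (f : V → F) : Lp F 2 π :=
  if h : MemLp f 2 π then h.toLp f else 0

theorem toL2_of_memLp {f : V → F} (h : MemLp f 2 π) : toL2 π f = h.toLp f := dif_pos h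

theorem toL2_congr {f f' : V → F} (h : f =ᵐ[π] f') : toL2 π f = toL2 π f' := by
  by_cases hf : MemLp f 2 π
  · rw [toL2_of_memLp hf, toL2_of_memLp (hf.ae_eq h)]
    exact MemLp.toLp_congr _ _ h
  · have hf' : ¬ MemLp f' 2 π := fun h' => hf (h'.ae_eq h.symm)
    rw [toL2, toL2, dif_neg hf, dif_neg hf']

theorem toL2_add {f f' : V → F} (h : MemLp f 2 π) (h' : MemLp f' 2 π) :
    toL2 π (f + f') = toL2 π f + toL2 π f' := by
  rw [toL2_of_memLp h, toL2_of_memLp h', toL2_of_memLp (h.add h')]; rfl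

theorem toL2_smul (c : ℝ) {f : V → F} (h : MemLp f 2 π) : toL2 π (c • f) = c • toL2 π f := by
  rw [toL2_of_memLp h, toL2_of_memLp (h.const_smul c)]; rfl

theorem enorm_toL2 {f : V → F} (h : MemLp f 2 π) : ‖toL2 π f‖ₑ = eLpNorm f 2 π := by
  rw [toL2_of_memLp h, Lp.enorm_toLp]

theorem toL2_indicator_stronglyMeasurable (c : F) {B : Set (X × V)} (hB : MeasurableSet B) :
    StronglyMeasurable fun g : X => toL2 π fun v => B.indicator (fun _ => c) (g, v) := by
  have key : ∀ {B : Set (X × V)} (hB : MeasurableSet B) (g : X),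
      (toL2 π fun v => B.indicator (fun _ => c) (g, v))
        = indicatorConstLp 2 (measurable_prodMk_left (x := g) hB) (measure_ne_top π _) c := by
    intro B hB g
    exact toL2_of_memLp (memLp_indicator_const 2 (measurable_prodMk_left (x := g) hB) c
      (Or.inr (measure_ne_top π _)))
  induction B, hB using MeasurableSpace.induction_on_inter generateFrom_prod.symm isPiSystem_prod
    with
  | empty =>
    have : (fun g : X => toL2 π fun v => (∅ : Set (X × V)).indicator (fun _ => c) (g, v))
        = fun _ => toL2 π fun _ => (0 : F) := by
      ext1 g; simp
    rw [this]; exact stronglyMeasurable_const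
  | basic B hB =>
    obtain ⟨A, hA, C, hC, rfl⟩ := hB
    have : (fun g : X => toL2 π fun v => (A ×ˢ C).indicator (fun _ => c) (g, v))
        = A.indicator fun _ => toL2 π (C.indicator fun _ => c) := by
      ext1 g
      have h0 : toL2 π (fun _ => (0 : F)) = 0 := by
        have := toL2_smul (π := π) 0 (f := fun _ : V => (0 : F)) MemLp.zero
        rw [zero_smul, zero_smul] at this
        exact this
      by_cases hg : g ∈ A
      · simp only [Set.indicator_of_mem hg]
        congr 1
        ext v
        by_cases hv : v ∈ C <;> simp [hg, hv]
      · simp only [Set.indicator_of_notMem hg]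
        rw [← h0]
        congr 1
        ext v
        simp [hg]
    rw [this]
    exact stronglyMeasurable_const.indicator hA
  | compl B hB ih =>
    have : (fun g : X => toL2 π fun v => Bᶜ.indicator (fun _ => c) (g, v))
        = fun g => toL2 π (fun _ => c) - toL2 π fun v => B.indicator (fun _ => c) (g, v) := by
      ext1 g
      rw [eq_sub_iff_add_eq, ← toL2_add]
      · congr 1
        ext v
        exact congrFun (Set.indicator_compl_add_self B (fun _ => c)) (g, v)
      · exact memLp_indicator_const 2 (measurable_prodMk_left (x := g) hB.compl) c
          (Or.inr (measure_ne_top π _))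
      · exact memLp_indicator_const 2 (measurable_prodMk_left (x := g) hB) c
          (Or.inr (measure_ne_top π _))
    rw [this]
    exact stronglyMeasurable_const.sub ih
  | iUnion B hd hB ih =>
    have hfin : ∀ n : ℕ, MeasurableSet (⋃ i ∈ Finset.range n, B i) := fun n =>
      Finset.measurableSet_biUnion _ fun i _ => hB i
    have hfm : ∀ n : ℕ, StronglyMeasurable fun g : X =>
        toL2 π fun v => (⋃ i ∈ Finset.range n, B i).indicator (fun _ => c) (g, v) := by
      intro n
      have : (fun g : X => toL2 π fun v =>
          (⋃ i ∈ Finset.range n, B i).indicator (fun _ => c) (g, v))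
          = fun g => ∑ i ∈ Finset.range n, toL2 π fun v => (B i).indicator (fun _ => c) (g, v) := by
        ext1 g
        induction n with
        | zero =>
          have := toL2_smul (π := π) 0 (f := fun _ : V => (0 : F)) MemLp.zero
          rw [zero_smul, zero_smul] at this
          simp only [Finset.range_zero, Finset.sum_empty, Finset.notMem_empty, Set.iUnion_of_empty,
            Set.iUnion_empty, Set.indicator_empty]
          exact this
        | succ n ihn =>
          rw [Finset.sum_range_succ, ← ihn, ← toL2_add]
          · congr 1
            ext v
            have hdis : Disjoint (⋃ i ∈ Finset.range n, B i) (B n) := by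
              rw [Set.disjoint_iUnion₂_left]
              intro i hi
              exact hd (Finset.mem_range.1 hi).ne
            rw [Finset.range_add_one, Finset.set_biUnion_insert, Set.union_comm]
            exact congrFun (Set.indicator_union_of_disjoint hdis (fun _ => c)) (g, v)
          · exact memLp_indicator_const 2 (measurable_prodMk_left (x := g) (hfin n)) c
              (Or.inr (measure_ne_top π _))
          · exact memLp_indicator_const 2 (measurable_prodMk_left (x := g) (hB n)) c
              (Or.inr (measure_ne_top π _))
      rw [this]
      exact Finset.stronglyMeasurable_fun_sum _ fun i _ => ih i
    refine stronglyMeasurable_of_tendsto atTop hfm (tendsto_pi_nhds.2 fun g => ?_)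
    simp only [key (hfin _), key (MeasurableSet.iUnion hB)]
    refine tendsto_indicatorConstLp_set (by norm_num) ?_
    have hsub : ∀ n : ℕ, symmDiff (Prod.mk g ⁻¹' ⋃ i ∈ Finset.range n, B i)
        (Prod.mk g ⁻¹' ⋃ i, B i) = (Prod.mk g ⁻¹' ⋃ i, B i) \
          (Prod.mk g ⁻¹' ⋃ i ∈ Finset.range n, B i) := fun n =>
      symmDiff_of_le (Set.preimage_mono
        (Set.iUnion₂_subset fun i _ => Set.subset_iUnion B i))
    simp only [hsub]
    have hlim := tendsto_measure_iInter_atTop (μ := π)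
      (s := fun n : ℕ => (Prod.mk g ⁻¹' ⋃ i, B i) \ (Prod.mk g ⁻¹' ⋃ i ∈ Finset.range n, B i))
      (fun n => ((measurable_prodMk_left (MeasurableSet.iUnion hB)).diff
        (measurable_prodMk_left (hfin n))).nullMeasurableSet)
      (fun m n hmn => Set.sdiff_subset_sdiff_right (Set.preimage_mono
        (Set.biUnion_subset_biUnion_left fun i hi =>
          Finset.mem_range.2 ((Finset.mem_range.1 hi).trans_le hmn))))
      ⟨0, measure_ne_top _ _⟩
    have hemp : (⋂ n : ℕ, (Prod.mk g ⁻¹' ⋃ i, B i) \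
        (Prod.mk g ⁻¹' ⋃ i ∈ Finset.range n, B i)) = ∅ := by
      refine Set.eq_empty_of_forall_notMem fun v hv => ?_
      simp only [Set.mem_iInter] at hv
      obtain ⟨i, hi⟩ := Set.mem_iUnion.1 (hv 0).1
      exact (hv (i + 1)).2 (Set.mem_iUnion₂.2 ⟨i, by simp, hi⟩)
    rw [hemp, measure_empty] at hlim
    exact hlim

theorem memLp_slice {f : X × V → F} (hf : MemLp f 2 (μ.prod π)) :
    ∀ᵐ g ∂μ, MemLp (fun v => f (g, v)) 2 π := by
  have hfin : ∫⁻ p, ‖f p‖ₑ ^ 2 ∂(μ.prod π) ≠ ∞ := by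
    rw [← eLpNorm_two_sq]; exact ENNReal.pow_ne_top hf.2.ne
  have hme : AEMeasurable (fun p => ‖f p‖ₑ ^ 2) (μ.prod π) := hf.1.enorm.pow_const 2
  rw [lintegral_prod _ hme] at hfin
  filter_upwards [ae_lt_top' hme.lintegral_prod_right' hfin, hf.1.prodMk_left] with g hg hg'
  refine ⟨hg', ?_⟩
  have : eLpNorm (fun v => f (g, v)) 2 π ^ 2 < ∞ := by
    rw [eLpNorm_two_sq]; exact hg
  by_contra hcon
  rw [not_lt_top_iff.1 hcon] at this
  simp at this

theorem toL2_slice_aestronglyMeasurable {f : X × V → F} (hf : MemLp f 2 (μ.prod π)) :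
    AEStronglyMeasurable (fun g => toL2 π fun v => f (g, v)) μ := by
  borelize F
  set f' := hf.1.mk f with hf'
  have hsm : StronglyMeasurable f' := hf.1.stronglyMeasurable_mk
  have hae : f =ᵐ[μ.prod π] f' := hf.1.ae_eq_mk
  have hf'L : MemLp f' 2 (μ.prod π) := hf.ae_eq hae
  have hcongr : (fun g => toL2 π fun v => f (g, v)) =ᵐ[μ] fun g => toL2 π fun v => f' (g, v) := by
    filter_upwards [Measure.ae_ae_of_ae_prod hae] with g hg
    exact toL2_congr hg
  refine AEStronglyMeasurable.congr ?_ hcongr.symm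
  have hsep := hsm.isSeparable_range
  have : TopologicalSpace.SeparableSpace (Set.range f' ∪ {0} : Set F) :=
    hsm.separableSpace_range_union_singleton
  have h0 : (0 : F) ∈ Set.range f' ∪ {0} := by simp
  set φ := SimpleFunc.approxOn f' hsm.measurable (Set.range f' ∪ {0}) 0 h0 with hφ
  have hbddm : ∀ ψ : SimpleFunc (X × V) F, ∀ g, MemLp (fun v => ψ (g, v)) 2 π := by
    intro ψ g
    obtain ⟨C, hC⟩ := ψ.exists_forall_norm_le
    exact MemLp.of_bound
      (ψ.stronglyMeasurable.comp_measurable measurable_prodMk_left).aestronglyMeasurable C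
      (ae_of_all _ fun v => hC _)
  have hsimple : ∀ ψ : SimpleFunc (X × V) F,
      StronglyMeasurable fun g => toL2 π fun v => ψ (g, v) := by
    intro ψ
    induction ψ using SimpleFunc.induction with
    | const c hs =>
      simp only [SimpleFunc.coe_piecewise, SimpleFunc.coe_const]
      exact toL2_indicator_stronglyMeasurable c hs
    | add hd h1 h2 =>
      rename_i ψ₁ ψ₂
      have : (fun g => toL2 π fun v => (ψ₁ + ψ₂) (g, v))
          = fun g => (toL2 π fun v => ψ₁ (g, v)) + toL2 π fun v => ψ₂ (g, v) := by
        ext1 g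
        exact toL2_add (hbddm ψ₁ g) (hbddm ψ₂ g)
      rw [this]
      exact h1.add h2
  have hgood := memLp_slice hf'L
  refine aestronglyMeasurable_of_tendsto_ae atTop
    (f := fun n g => toL2 π fun v => φ n (g, v))
    (fun n => (hsimple (φ n)).aestronglyMeasurable) ?_
  filter_upwards [hgood] with g hg
  rw [toL2_of_memLp hg]
  have heq : ∀ n, (toL2 π fun v => φ n (g, v)) = (hbddm (φ n) g).toLp _ := fun n =>
    toL2_of_memLp (hbddm (φ n) g)
  simp only [heq]
  refine (Lp.tendsto_Lp_iff_tendsto_eLpNorm'' _ _ _ _).2 ?_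
  have hm : Measurable fun v => f' (g, v) := hsm.measurable.comp measurable_prodMk_left
  have := SimpleFunc.tendsto_approxOn_Lp_eLpNorm (p := 2) (μ := π) hm h0 (by norm_num)
    (ae_of_all _ fun v => subset_closure (Or.inl ⟨_, rfl⟩)) (by simpa using hg.2)
  refine this.congr fun n => ?_
  congr 1

/-- Collecting the values of `x` along the family `r` in an element of `L²(π, F)`. -/
def collect (π : Measure V) (r : X × V → X) (x : X → F) (g : X) : Lp F 2 π :=
  toL2 π fun v => x (r (g, v))

variable {r : X × V → X}

theorem memLp_family (hr : Measurable r) (hp : ∀ v, MeasurePreserving (fun g => r (g, v)) μ μ)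
    {x : X → F} (hx : MemLp x 2 μ) : MemLp (fun p => x (r p)) 2 (μ.prod π) := by
  have hm : AEStronglyMeasurable (fun p => x (r p)) (μ.prod π) :=
    hx.1.comp_quasiMeasurePreserving (qmp_family (π := π) hr hp)
  refine ⟨hm, ?_⟩
  have h := lintegral_family (π := π) hr hp (f := fun g => ‖x g‖ₑ ^ 2) (hx.1.enorm.pow_const 2)
    (k := fun _ => 1) aemeasurable_const
  have h2 : eLpNorm (fun p => x (r p)) 2 (μ.prod π) ^ 2 < ∞ := by
    rw [eLpNorm_two_sq, lintegral_prod _ (hm.enorm.pow_const 2)]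
    simp only [one_mul, lintegral_const, measure_univ, mul_one] at h
    refine lt_of_eq_of_lt h ?_
    rw [← eLpNorm_two_sq]
    exact ENNReal.pow_lt_top hx.2
  by_contra hcon
  rw [not_lt_top_iff.1 hcon] at h2
  simp at h2

theorem collect_aestronglyMeasurable (hr : Measurable r)
    (hp : ∀ v, MeasurePreserving (fun g => r (g, v)) μ μ) {x : X → F} (hx : MemLp x 2 μ) :
    AEStronglyMeasurable (collect π r x) μ :=
  toL2_slice_aestronglyMeasurable (memLp_family hr hp hx)

theorem collect_eLpNorm (hr : Measurable r)
    (hp : ∀ v, MeasurePreserving (fun g => r (g, v)) μ μ) {x : X → F} (hx : MemLp x 2 μ) :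
    eLpNorm (collect π r x) 2 μ = eLpNorm x 2 μ := by
  have h := lintegral_family (π := π) hr hp (f := fun g => ‖x g‖ₑ ^ 2) (hx.1.enorm.pow_const 2)
    (k := fun _ => 1) aemeasurable_const
  simp only [one_mul, lintegral_const, measure_univ, mul_one] at h
  refine (ENNReal.pow_right_strictMono (n := 2) (by norm_num)).injective ?_
  rw [eLpNorm_two_sq, eLpNorm_two_sq, ← h]
  refine lintegral_congr_ae ?_
  filter_upwards [memLp_slice (memLp_family (π := π) hr hp hx)] with g hg
  rw [collect, enorm_toL2 hg, eLpNorm_two_sq]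

theorem collect_congr (hr : Measurable r)
    (hp : ∀ v, MeasurePreserving (fun g => r (g, v)) μ μ) {x y : X → F}
    (hxy : x =ᵐ[μ] y) : collect π r x =ᵐ[μ] collect π r y := by
  filter_upwards [Measure.ae_ae_of_ae_prod ((qmp_family (π := π) hr hp).ae_eq_comp hxy)] with g hg
  exact toL2_congr hg

theorem collect_add (hr : Measurable r)
    (hp : ∀ v, MeasurePreserving (fun g => r (g, v)) μ μ)
    {x y : X → F} (hx : MemLp x 2 μ) (hy : MemLp y 2 μ) :
    collect π r (x + y) =ᵐ[μ] collect π r x + collect π r y := by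
  filter_upwards [memLp_slice (memLp_family (π := π) hr hp hx),
    memLp_slice (memLp_family (π := π) hr hp hy)] with g h1 h2
  exact toL2_add h1 h2

theorem collect_smul (hr : Measurable r)
    (hp : ∀ v, MeasurePreserving (fun g => r (g, v)) μ μ) (c : ℝ) {x : X → F}
    (hx : MemLp x 2 μ) : collect π r (c • x) =ᵐ[μ] c • collect π r x := by
  filter_upwards [memLp_slice (memLp_family (π := π) hr hp hx)] with g h1
  exact toL2_smul c h1

end Slice
end Generic

/-! ### The semi-direct product `ℝ^d ⋊ H` -/

/-- The Euclidean space `ℝ^d`. -/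
abbrev Euc (d : ℕ) : Type := EuclideanSpace ℝ (Fin d)

variable {d : ℕ} {H : Type*} [Group H]

/-- The action of `H` on the additive group `ℝ^d`, written multiplicatively. -/
def rotAut (ρ : H →* (Euc d ≃ₗᵢ[ℝ] Euc d)) : H →* MulAut (Multiplicative (Euc d)) where
  toFun a := AddEquiv.toMultiplicative (ρ a).toLinearEquiv.toAddEquiv
  map_one' := by ext v; simp
  map_mul' a b := by ext v; simp

/-- The group `ℝ^d ⋊ H`, with product `(u, a) (v, b) = (u + ρ a v, a b)`. -/
abbrev SemiGroup (ρ : H →* (Euc d ≃ₗᵢ[ℝ] Euc d)) : Type _ :=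
  Multiplicative (Euc d) ⋊[rotAut ρ] H

/-- Coordinates: `(u, a) ∈ ℝ^d ⋊ H` as an element of `ℝ^d × H`. -/
def coords (ρ : H →* (Euc d ≃ₗᵢ[ℝ] Euc d)) : SemiGroup ρ ≃ Euc d × H where
  toFun g := (g.left.toAdd, g.right)
  invFun p := ⟨Multiplicative.ofAdd p.1, p.2⟩

/-- The element `(v, e)` of `ℝ^d ⋊ H`. -/
def trans (ρ : H →* (Euc d ≃ₗᵢ[ℝ] Euc d)) (v : Euc d) : SemiGroup ρ :=
  SemidirectProduct.inl (Multiplicative.ofAdd v)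

theorem coords_mul (ρ : H →* (Euc d ≃ₗᵢ[ℝ] Euc d)) (g g' : SemiGroup ρ) :
    coords ρ (g * g') =
      ((coords ρ g).1 + ρ (coords ρ g).2 (coords ρ g').1, (coords ρ g).2 * (coords ρ g').2) :=
  rfl

theorem coords_mul_trans (ρ : H →* (Euc d ≃ₗᵢ[ℝ] Euc d)) (g : SemiGroup ρ) (v : Euc d) :
    coords ρ (g * trans ρ v) = ((coords ρ g).1 + ρ (coords ρ g).2 v, (coords ρ g).2) := by
  rw [coords_mul]; simp [trans, coords]

theorem coords_trans_inv_mul (ρ : H →* (Euc d ≃ₗᵢ[ℝ] Euc d)) (v : Euc d) (g : SemiGroup ρ) :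
    coords ρ ((trans ρ v)⁻¹ * g) = ((coords ρ g).1 - v, (coords ρ g).2) := by
  rw [trans, ← map_inv, coords_mul]
  simp [coords, sub_eq_neg_add]

section Measure

variable [TopologicalSpace H] [MeasurableSpace H] [BorelSpace H]

/-- The Borel sets of `ℝ^d ⋊ H` are those of `ℝ^d × H`. -/
instance semiGroupMeasurableSpace (ρ : H →* (Euc d ≃ₗᵢ[ℝ] Euc d)) :
    MeasurableSpace (SemiGroup ρ) :=
  MeasurableSpace.comap (coords ρ) inferInstance

/-- `coords` as a measurable equivalence. -/
def coordsM (ρ : H →* (Euc d ≃ₗᵢ[ℝ] Euc d)) : SemiGroup ρ ≃ᵐ Euc d × H where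
  toEquiv := coords ρ
  measurable_toFun := comap_measurable _
  measurable_invFun := by
    refine measurable_comap_iff.2 ?_
    exact measurable_id

/-- The measure `du dν(a)` on `ℝ^d ⋊ H`; it is the left Haar measure if `ν` is one on `H`. -/
def semiHaar (ρ : H →* (Euc d ≃ₗᵢ[ℝ] Euc d)) (ν : Measure H) : Measure (SemiGroup ρ) :=
  ((volume : Measure (Euc d)).prod ν).map (coordsM ρ).symm

instance (ρ : H →* (Euc d ≃ₗᵢ[ℝ] Euc d)) (ν : Measure H) [SFinite ν] :
    SFinite (semiHaar ρ ν) := by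
  unfold semiHaar; infer_instance

theorem coordsM_measurePreserving (ρ : H →* (Euc d ≃ₗᵢ[ℝ] Euc d)) (ν : Measure H) :
    MeasurePreserving (coordsM ρ) (semiHaar ρ ν) ((volume : Measure (Euc d)).prod ν) :=
  ((coordsM ρ).symm.measurable.measurePreserving _).symm

/-- A map of `ℝ^d ⋊ H` that is measure preserving in coordinates is measure preserving. -/
theorem measurePreserving_of_coords (ρ : H →* (Euc d ≃ₗᵢ[ℝ] Euc d)) (ν : Measure H)
    {T : SemiGroup ρ → SemiGroup ρ} {T' : Euc d × H → Euc d × H}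
    (hT' : MeasurePreserving T' ((volume : Measure (Euc d)).prod ν) (volume.prod ν))
    (h : ∀ g, coords ρ (T g) = T' (coords ρ g)) :
    MeasurePreserving T (semiHaar ρ ν) (semiHaar ρ ν) := by
  have hc := coordsM_measurePreserving ρ ν
  have : T = (coordsM ρ).symm ∘ T' ∘ coordsM ρ := by
    ext1 g
    exact ((coords ρ).symm_apply_eq.2 (h g).symm).symm
  rw [this]
  exact (hc.symm).comp (hT'.comp hc)

theorem shear_measurePreserving (ν : Measure H) [SFinite ν] {w : H → Euc d} (hw : Measurable w) :
    MeasurePreserving (fun p : Euc d × H => (p.1 + w p.2, p.2))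
      ((volume : Measure (Euc d)).prod ν) (volume.prod ν) := by
  have h1 : MeasurePreserving (fun p : H × Euc d => (p.1, p.2 + w p.1))
      (ν.prod (volume : Measure (Euc d))) (ν.prod volume) :=
    (MeasurePreserving.id ν).skew_product (g := fun a u => u + w a)
      (measurable_snd.add (hw.comp measurable_fst))
      (ae_of_all _ fun a => (measurePreserving_add_right volume (w a)).map_eq)
  exact (Measure.measurePreserving_swap (μ := ν) (ν := (volume : Measure (Euc d)))).comp
    (h1.comp (Measure.measurePreserving_swap (μ := (volume : Measure (Euc d))) (ν := ν)))

theorem mul_trans_measurePreserving {ρ : H →* (Euc d ≃ₗᵢ[ℝ] Euc d)}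
    (hρ : Continuous fun p : H × Euc d => ρ p.1 p.2) (ν : Measure H) [SFinite ν] (v : Euc d) :
    MeasurePreserving (fun g => g * trans ρ v) (semiHaar ρ ν) (semiHaar ρ ν) := by
  have hw : Measurable fun a => ρ a v :=
    (hρ.comp (continuous_id.prodMk continuous_const)).measurable
  exact measurePreserving_of_coords ρ ν (shear_measurePreserving ν hw)
    fun g => coords_mul_trans ρ g v

theorem mul_trans_measurable {ρ : H →* (Euc d ≃ₗᵢ[ℝ] Euc d)}
    (hρ : Continuous fun p : H × Euc d => ρ p.1 p.2) :
    Measurable fun p : SemiGroup ρ × Euc d => p.1 * trans ρ p.2 := by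
  have h : Measurable fun p : H × Euc d => ρ p.1 p.2 := hρ.measurable
  refine measurable_comap_iff.2 ?_
  have hc : Measurable (coords ρ) := (coordsM ρ).measurable
  have : (coords ρ ∘ fun p : SemiGroup ρ × Euc d => p.1 * trans ρ p.2)
      = fun p => ((coords ρ p.1).1 + ρ (coords ρ p.1).2 p.2, (coords ρ p.1).2) := by
    ext1 p; exact coords_mul_trans ρ p.1 p.2
  rw [this]
  have h1 : Measurable fun p : SemiGroup ρ × Euc d => coords ρ p.1 := hc.comp measurable_fst
  exact (h1.fst.add (h.comp (h1.snd.prodMk measurable_snd))).prodMk h1.snd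

/-- `semiHaar ρ ν` is invariant under left translations. -/
theorem semiHaar_mul_left [IsTopologicalGroup H] (ρ : H →* (Euc d ≃ₗᵢ[ℝ] Euc d))
    (ν : Measure H) [SFinite ν] [ν.IsMulLeftInvariant] (g : SemiGroup ρ) :
    (semiHaar ρ ν).map (fun g' => g * g') = semiHaar ρ ν := by
  have h1 : MeasurePreserving (fun u : Euc d => (coords ρ g).1 + ρ (coords ρ g).2 u) volume
      volume :=
    (measurePreserving_add_left volume _).comp (ρ (coords ρ g).2).measurePreserving
  have h2 : MeasurePreserving (fun a : H => (coords ρ g).2 * a) ν ν :=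
    ⟨(continuous_const_mul _).measurable, map_mul_left_eq_self ν _⟩
  exact (measurePreserving_of_coords ρ ν (h1.prod h2) fun g' => coords_mul ρ g g').map_eq

/-! ### Pooling and patch extraction -/

variable {F : Type*} [NormedAddCommGroup F] [NormedSpace ℝ F]

/-- The dilated filter `h_σ(v) = σ^{-d} h(v / σ)`. -/
def dilate (h : Euc d → ℝ) (σ : ℝ) (v : Euc d) : ℝ := (σ ^ d)⁻¹ * h (σ⁻¹ • v)

theorem dilate_integrable {h : Euc d → ℝ} (hh : Integrable h) {σ : ℝ} (hσ : 0 < σ) :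
    Integrable (dilate h σ) :=
  (hh.comp_smul (inv_ne_zero hσ.ne')).const_mul _

/-- The pooling operator `A` on `L²(G, F)`, `G = ℝ^d ⋊ H`, of a filter `h` at scale `σ`:
`A x (g) = ∫ x (g (v, e)) h_σ(v) dv`. -/
def poolOp (F : Type*) [NormedAddCommGroup F] [NormedSpace ℝ F]
    {ρ : H →* (Euc d ≃ₗᵢ[ℝ] Euc d)}
    (hρ : Continuous fun p : H × Euc d => ρ p.1 p.2) (ν : Measure H) [SFinite ν]
    {h : Euc d → ℝ} (hh : Integrable h) {σ : ℝ} (hσ : 0 < σ) :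
    Lp F 2 (semiHaar ρ ν) →L[ℝ] Lp F 2 (semiHaar ρ ν) :=
  have hr := mul_trans_measurable hρ
  have hp := mul_trans_measurePreserving hρ ν
  have hk := dilate_integrable hh hσ
  l2Op _ _ (fun x g => ∫ v, dilate h σ v • x (g * trans ρ v)) _
    (fun _ hx => avg_aestronglyMeasurable hr hp hk hx)
    (fun _ hx => avg_eLpNorm_le hr hp hk hx)
    (fun _ _ _ hxy => avg_congr hr hp _ hxy)
    (fun _ _ hx hy => avg_add hr hp hk hx hy)
    (fun c x _ => .of_eq (avg_smul (r := fun p : SemiGroup ρ × Euc d => p.1 * trans ρ p.2) _ c x))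

/-- The patch extraction operator `P : L²(G, F) → L²(G, L²(S, F))` of a patch shape
`S × {e} ⊆ G = ℝ^d ⋊ H`, where `π` is the measure on `S`: `P x (g) = (x (g (v, e)))_{v ∈ S}`. -/
def patchOp (F : Type*) [NormedAddCommGroup F] [NormedSpace ℝ F]
    {ρ : H →* (Euc d ≃ₗᵢ[ℝ] Euc d)}
    (hρ : Continuous fun p : H × Euc d => ρ p.1 p.2) (ν : Measure H) [SFinite ν]
    {S : Set (Euc d)} (π : Measure S) [IsProbabilityMeasure π] :
    Lp F 2 (semiHaar ρ ν) →L[ℝ] Lp (Lp F 2 π) 2 (semiHaar ρ ν) :=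
  have hr : Measurable fun p : SemiGroup ρ × S => p.1 * trans ρ (p.2 : Euc d) :=
    (mul_trans_measurable hρ).comp
      (measurable_fst.prodMk (measurable_subtype_coe.comp measurable_snd))
  have hp : ∀ v : S, MeasurePreserving (fun g => g * trans ρ (v : Euc d)) (semiHaar ρ ν) _ :=
    fun v => mul_trans_measurePreserving hρ ν v
  l2Op _ _ (fun x g => toL2 π fun v : S => x (g * trans ρ (v : Euc d))) 1
    (fun _ hx => collect_aestronglyMeasurable hr hp hx)
    (fun _ hx => by rw [ENNReal.coe_one, one_mul]; exact (collect_eLpNorm hr hp hx).le)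
    (fun _ _ _ hxy => collect_congr hr hp hxy)
    (fun _ _ hx hy => collect_add hr hp hx hy)
    (fun c _ hx => collect_smul hr hp c hx)

/-! ### Deformation -/

theorem sub_antilipschitz {τ : Euc d → Euc d} (hτ : ContDiff ℝ 1 τ)
    (hτ' : ∀ u, ‖fderiv ℝ τ u‖ ≤ 1 / 2) : AntilipschitzWith 2 fun u => u - τ u := by
  have hL : LipschitzWith (1 / 2 : ℝ≥0) τ :=
    lipschitzWith_of_nnnorm_fderiv_le (hτ.differentiable (by norm_num)) fun u => by
      rw [← NNReal.coe_le_coe]; simpa using hτ' u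
  refine AntilipschitzWith.of_le_mul_dist fun u v => ?_
  have h1 := hL.dist_le_mul u v
  rw [dist_eq_norm, dist_eq_norm] at *
  have h2 : ‖u - v‖ ≤ ‖u - τ u - (v - τ v)‖ + ‖τ u - τ v‖ := by
    have : u - v = (u - τ u - (v - τ v)) + (τ u - τ v) := by abel
    calc ‖u - v‖ = ‖(u - τ u - (v - τ v)) + (τ u - τ v)‖ := by rw [← this]
      _ ≤ _ := norm_add_le _ _
  push_cast at *
  linarith

theorem volume_preimage_le {T : Euc d → Euc d} (hT : AntilipschitzWith 2 T) (s : Set (Euc d)) :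
    volume (T ⁻¹' s) ≤ 2 ^ d * volume s := by
  have h1 := hT.hausdorffMeasure_preimage_le (d := (d : ℝ)) (by positivity) s
  have hfr : Module.finrank ℝ (Euc d) = d := finrank_euclideanSpace_fin
  obtain ⟨c, h2⟩ : ∃ c : ℝ≥0, (volume : Measure (Euc d))
      = c • Measure.hausdorffMeasure (Module.finrank ℝ (Euc d)) :=
    ⟨_, Measure.isAddLeftInvariant_eq_smul _ _⟩
  rw [hfr] at h2
  rw [h2, Measure.smul_apply, Measure.smul_apply, ENNReal.smul_def, ENNReal.smul_def, smul_eq_mul,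
    smul_eq_mul, mul_left_comm]
  gcongr
  simpa using h1

/-- The deformation `(u, a) ↦ (τ u, e)⁻¹ (u, a)` of `ℝ^d ⋊ H`. -/
def deform (ρ : H →* (Euc d ≃ₗᵢ[ℝ] Euc d)) (τ : Euc d → Euc d) (g : SemiGroup ρ) : SemiGroup ρ :=
  (trans ρ (τ g.left.toAdd))⁻¹ * g

theorem deform_eq (ρ : H →* (Euc d ≃ₗᵢ[ℝ] Euc d)) (τ : Euc d → Euc d) :
    deform ρ τ = (coordsM ρ).symm ∘ (fun p => (p.1 - τ p.1, p.2)) ∘ coordsM ρ := by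
  ext1 g
  exact ((coords ρ).symm_apply_eq.2 (coords_trans_inv_mul ρ _ g).symm).symm

theorem deform_measurable (ρ : H →* (Euc d ≃ₗᵢ[ℝ] Euc d)) {τ : Euc d → Euc d}
    (hτ : ContDiff ℝ 1 τ) : Measurable (deform ρ τ) := by
  rw [deform_eq]
  have h1 : Measurable τ := hτ.continuous.measurable
  exact (coordsM ρ).symm.measurable.comp
    (((measurable_fst.sub (h1.comp measurable_fst)).prodMk measurable_snd).comp
      (coordsM ρ).measurable)

theorem deform_map_le (ρ : H →* (Euc d ≃ₗᵢ[ℝ] Euc d)) (ν : Measure H) [SFinite ν]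
    {τ : Euc d → Euc d} (hτ : ContDiff ℝ 1 τ) (hτ' : ∀ u, ‖fderiv ℝ τ u‖ ≤ 1 / 2) :
    (semiHaar ρ ν).map (deform ρ τ) ≤ (2 ^ d : ℝ≥0∞) • semiHaar ρ ν := by
  have hT : Measurable fun p : Euc d × H => (p.1 - τ p.1, p.2) :=
    (measurable_fst.sub (hτ.continuous.measurable.comp measurable_fst)).prodMk measurable_snd
  refine Measure.le_intro fun s hs _ => ?_
  rw [Measure.map_apply (deform_measurable ρ hτ) hs, Measure.smul_apply, smul_eq_mul, semiHaar,
    Measure.map_apply (coordsM ρ).symm.measurable hs,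
    Measure.map_apply (coordsM ρ).symm.measurable (deform_measurable ρ hτ hs)]
  have hs' := (coordsM ρ).symm.measurable hs
  have : (coordsM ρ).symm ⁻¹' (deform ρ τ ⁻¹' s)
      = (fun p : Euc d × H => (p.1 - τ p.1, p.2)) ⁻¹' ((coordsM ρ).symm ⁻¹' s) := by
    rw [deform_eq]
    ext p
    simp
  rw [this, Measure.prod_apply_symm (hT hs'), Measure.prod_apply_symm hs',
    ← lintegral_const_mul _ (measurable_measure_prodMk_right hs')]
  refine lintegral_mono fun a => ?_
  exact volume_preimage_le (sub_antilipschitz hτ hτ') ((fun u => (u, a)) ⁻¹' _)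

theorem deform_qmp (ρ : H →* (Euc d ≃ₗᵢ[ℝ] Euc d)) (ν : Measure H) [SFinite ν]
    {τ : Euc d → Euc d} (hτ : ContDiff ℝ 1 τ) (hτ' : ∀ u, ‖fderiv ℝ τ u‖ ≤ 1 / 2) :
    Measure.QuasiMeasurePreserving (deform ρ τ) (semiHaar ρ ν) (semiHaar ρ ν) :=
  ⟨deform_measurable ρ hτ, (Measure.absolutelyContinuous_of_le (deform_map_le ρ ν hτ hτ')).trans
    (Measure.smul_absolutelyContinuous)⟩

theorem deform_eLpNorm_le (ρ : H →* (Euc d ≃ₗᵢ[ℝ] Euc d)) (ν : Measure H) [SFinite ν]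
    {τ : Euc d → Euc d} (hτ : ContDiff ℝ 1 τ) (hτ' : ∀ u, ‖fderiv ℝ τ u‖ ≤ 1 / 2)
    {x : SemiGroup ρ → F} (hx : MemLp x 2 (semiHaar ρ ν)) :
    eLpNorm (fun g => x (deform ρ τ g)) 2 (semiHaar ρ ν)
      ≤ ((2 ^ d : ℝ≥0) : ℝ≥0∞) * eLpNorm x 2 (semiHaar ρ ν) := by
  refine le_mul_of_sq_le ?_
  rw [eLpNorm_two_sq, eLpNorm_two_sq]
  have hq := deform_qmp ρ ν hτ hτ'
  have h1 : ∫⁻ g, ‖x (deform ρ τ g)‖ₑ ^ 2 ∂(semiHaar ρ ν)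
      = ∫⁻ g, ‖x g‖ₑ ^ 2 ∂((semiHaar ρ ν).map (deform ρ τ)) :=
    (lintegral_map' (f := fun g => ‖x g‖ₑ ^ 2) ((hx.1.enorm.pow_const 2).mono_ac hq.2)
      hq.1.aemeasurable).symm
  rw [h1]
  calc _ ≤ ∫⁻ g, ‖x g‖ₑ ^ 2 ∂((2 ^ d : ℝ≥0∞) • semiHaar ρ ν) :=
        lintegral_mono' (deform_map_le ρ ν hτ hτ') le_rfl
    _ = 2 ^ d * ∫⁻ g, ‖x g‖ₑ ^ 2 ∂(semiHaar ρ ν) := by rw [lintegral_smul_measure, smul_eq_mul]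
    _ ≤ _ := by
        refine mul_le_mul' ?_ le_rfl
        push_cast
        exact le_self_pow₀ (one_le_pow₀ (one_le_two : (1 : ℝ≥0∞) ≤ 2)) two_ne_zero

/-- The deformation operator `L_τ` on `L²(G, F)`, `G = ℝ^d ⋊ H`:
`L_τ x (u, a) = x ((τ u, e)⁻¹ (u, a)) = x (u - τ u, a)`. -/
def deformOp (F : Type*) [NormedAddCommGroup F] [NormedSpace ℝ F]
    (ρ : H →* (Euc d ≃ₗᵢ[ℝ] Euc d)) (ν : Measure H) [SFinite ν]
    {τ : Euc d → Euc d} (hτ : ContDiff ℝ 1 τ) (hτ' : ∀ u, ‖fderiv ℝ τ u‖ ≤ 1 / 2) :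
    Lp F 2 (semiHaar ρ ν) →L[ℝ] Lp F 2 (semiHaar ρ ν) :=
  have hq := deform_qmp ρ ν hτ hτ'
  l2Op _ _ (fun x g => x ((trans ρ (τ g.left.toAdd))⁻¹ * g)) (2 ^ d)
    (fun _ hx => hx.1.comp_quasiMeasurePreserving hq)
    (fun _ hx => deform_eLpNorm_le ρ ν hτ hτ' hx)
    (fun _ _ _ hxy => hq.ae_eq_comp hxy)
    (fun _ _ _ _ => .rfl)
    (fun _ _ _ => .rfl)

/-- The commutator `[P A, L_τ] = P A L_τ - L_τ P A : L²(G, F) → L²(G, L²(S, F))` of `P A` (pooling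
followed by patch extraction) with the deformation operator `L_τ`. The left factor `L_τ` acts on
`L²(S, F)`-valued signals. -/
def patchPoolCommutator (F : Type*) [NormedAddCommGroup F] [NormedSpace ℝ F]
    {ρ : H →* (Euc d ≃ₗᵢ[ℝ] Euc d)}
    (hρ : Continuous fun p : H × Euc d => ρ p.1 p.2) (ν : Measure H) [SFinite ν]
    {h : Euc d → ℝ} (hh : Integrable h) {σ : ℝ} (hσ : 0 < σ)
    {S : Set (Euc d)} (π : Measure S) [IsProbabilityMeasure π]
    {τ : Euc d → Euc d} (hτ : ContDiff ℝ 1 τ) (hτ' : ∀ u, ‖fderiv ℝ τ u‖ ≤ 1 / 2) :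
    Lp F 2 (semiHaar ρ ν) →L[ℝ] Lp (Lp F 2 π) 2 (semiHaar ρ ν) :=
  (patchOp F hρ ν π ∘L poolOp F hρ ν hh hσ) ∘L deformOp F ρ ν hτ hτ'
    - deformOp (Lp F 2 π) ρ ν hτ hτ' ∘L (patchOp F hρ ν π ∘L poolOp F hρ ν hh hσ)

/-! The three operators act on classes by their defining formulas. -/

theorem poolOp_ae {ρ : H →* (Euc d ≃ₗᵢ[ℝ] Euc d)}
    (hρ : Continuous fun p : H × Euc d => ρ p.1 p.2) (ν : Measure H) [SFinite ν]
    {h : Euc d → ℝ} (hh : Integrable h) {σ : ℝ} (hσ : 0 < σ) (x : Lp F 2 (semiHaar ρ ν)) :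
    poolOp F hρ ν hh hσ x =ᵐ[semiHaar ρ ν] fun g => ∫ v, dilate h σ v • x (g * trans ρ v) :=
  l2Op_ae x

theorem patchOp_ae {ρ : H →* (Euc d ≃ₗᵢ[ℝ] Euc d)}
    (hρ : Continuous fun p : H × Euc d => ρ p.1 p.2) (ν : Measure H) [SFinite ν]
    {S : Set (Euc d)} (π : Measure S) [IsProbabilityMeasure π] (x : Lp F 2 (semiHaar ρ ν)) :
    ∀ᵐ g ∂(semiHaar ρ ν), patchOp F hρ ν π x g =ᵐ[π] fun v : S => x (g * trans ρ (v : Euc d)) := by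
  have hr : Measurable fun p : SemiGroup ρ × S => p.1 * trans ρ (p.2 : Euc d) :=
    (mul_trans_measurable hρ).comp
      (measurable_fst.prodMk (measurable_subtype_coe.comp measurable_snd))
  have h1 : patchOp F hρ ν π x =ᵐ[semiHaar ρ ν]
      fun g => toL2 π fun v : S => x (g * trans ρ (v : Euc d)) := l2Op_ae x
  filter_upwards [h1, memLp_slice (memLp_family (π := π) hr
    (fun v => mul_trans_measurePreserving hρ ν v) (Lp.memLp x))] with g hg hg'
  rw [hg, toL2_of_memLp hg']
  exact hg'.coeFn_toLp

theorem deformOp_ae (ρ : H →* (Euc d ≃ₗᵢ[ℝ] Euc d)) (ν : Measure H) [SFinite ν]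
    {τ : Euc d → Euc d} (hτ : ContDiff ℝ 1 τ) (hτ' : ∀ u, ‖fderiv ℝ τ u‖ ≤ 1 / 2)
    (x : Lp F 2 (semiHaar ρ ν)) :
    deformOp F ρ ν hτ hτ' x =ᵐ[semiHaar ρ ν]
      fun g => x ((trans ρ (τ g.left.toAdd))⁻¹ * g) :=
  l2Op_ae x

end Measure

end CKN
end

/-! Every operator in the theorem preserves the fibres `ℝ^d × {a}` of the group. On such a fibre,
with `f u = x (u, a)`, pooling followed by the shift by a patch point `c` is `u ↦ ∫ k w • f (u +
w)`, where `k w = h_σ (ρ(a)⁻¹ w - c)`. Since `ρ(a)` preserves Lebesgue measure and norms, the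
relevant integrals of `k` are bounded independently of `a`. It remains to prove two `L²(ℝ^d)`
estimates uniform in `a` and `c`. Both express a difference as an integral operator and apply the
Schur test `schur_lintegral_sq_le`, the kernel being bounded by `∇k` integrated along a segment.

For `L_τ A - A` the kernel is `k (z - (u - τ u)) - k (z - u)`. Integrals over `z` cost `‖τ‖∞ ‖∇k‖₁`.
Integrals over `u` cost in addition the factor `2 ^ d` of the substitution `u ↦ u - t τ u`, whose
inverse is 2-Lipschitz. Schur's bound is the geometric mean `2 ^ (d / 2) ‖τ‖∞ ‖∇k‖₁`, and `‖∇k‖₁ ≤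
σ⁻¹ ‖∇h‖₁` (`lintegral_pool_sub_pool_le`).

For the commutator, the substitution `z = y - τ y` lets both terms integrate the same function `f (y
- τ y)`, with kernel `k (y - u) - J y * k (y - τ y - (u - τ u))` and `J = |det (1 - ∇τ)|`. Here `|1
- J|` is `O(‖∇τ‖∞)`, and the change of argument in `k` is `τ y - τ u`, at most `2 ‖∇τ‖∞` times the
length of the point `p` at which `∇k` is evaluated. So the bound needs only `‖k‖₁` and `∫ |p| |∇k
p|` (`lintegral_pool_deform_commutator_le`). Both are controlled independently of `σ` when `|c| ≤ κ
σ`. The estimate is uniform in `c`, so it survives integration against the probability measure `π`.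
-/

noncomputable section

set_option linter.unusedSectionVars false

namespace CKN

/-! ### Schur test, increments along segments, and the Jacobian determinant -/

section

/-- The Schur test. -/
theorem schur_lintegral_sq_le {α β : Type*} [MeasurableSpace α] [MeasurableSpace β]
    {μ : Measure α} {ν : Measure β} [SFinite μ] [SFinite ν] {N : α → β → ℝ≥0∞}
    (hN : Measurable (Function.uncurry N)) {A B : ℝ≥0∞}
    (hA : ∀ u, ∫⁻ y, N u y ∂ν ≤ A) (hB : ∀ y, ∫⁻ u, N u y ∂μ ≤ B)
    {f : β → ℝ≥0∞} (hf : Measurable f) :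
    ∫⁻ u, (∫⁻ y, N u y * f y ∂ν) ^ 2 ∂μ ≤ A * B * ∫⁻ y, f y ^ 2 ∂ν := by
  have hN1 : ∀ u, Measurable (N u) := fun u => hN.comp measurable_prodMk_left
  have hN2 : ∀ y, Measurable fun u => N u y := fun y => hN.comp measurable_prodMk_right
  have hm : Measurable (Function.uncurry fun u y => N u y * f y ^ 2) :=
    hN.mul ((hf.comp measurable_snd).pow_const 2)
  calc ∫⁻ u, (∫⁻ y, N u y * f y ∂ν) ^ 2 ∂μ
      ≤ ∫⁻ u, A * ∫⁻ y, N u y * f y ^ 2 ∂ν ∂μ := by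
        refine lintegral_mono fun u => ?_
        -- Cauchy–Schwarz for the measure with density `N u`.
        refine (sq_lintegral_mul_le (hN1 u).aemeasurable hf.aemeasurable).trans ?_
        gcongr
        exact hA u
    _ = A * ∫⁻ y, (∫⁻ u, N u y ∂μ) * f y ^ 2 ∂ν := by
        rw [lintegral_const_mul _ hm.lintegral_prod_right, lintegral_lintegral_swap hm.aemeasurable]
        congr 1
        exact lintegral_congr fun y => lintegral_mul_const _ (hN2 y)
    _ ≤ A * ∫⁻ y, B * f y ^ 2 ∂ν := by
        gcongr with y
        exact hB y
    _ = _ := by rw [lintegral_const_mul _ (hf.pow_const 2), mul_assoc]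

/-- The fundamental theorem of calculus on the segment from `a` to `b`. The bound stays an integral
over `t`, rather than a supremum, so that Tonelli can later exchange it with integrals over space
and only `L¹` norms of the gradient enter. -/
theorem enorm_sub_le_lintegral_fderiv {E : Type*} [NormedAddCommGroup E] [NormedSpace ℝ E]
    {k : E → ℝ} (hk : ContDiff ℝ 1 k) (a b : E) :
    ‖k b - k a‖ₑ ≤ ∫⁻ t in Set.Ioc (0 : ℝ) 1, ‖fderiv ℝ k (a + t • (b - a))‖ₑ * ‖b - a‖ₑ := by
  have hd : ∀ t : ℝ, HasDerivAt (fun t : ℝ => k (a + t • (b - a)))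
      (fderiv ℝ k (a + t • (b - a)) (b - a)) t := fun t => by
    have h1 : HasDerivAt (fun t : ℝ => a + t • (b - a)) (b - a) t := by
      simpa using ((hasDerivAt_id t).smul_const (b - a)).const_add a
    exact ((hk.differentiable one_ne_zero _).hasFDerivAt).comp_hasDerivAt t h1
  have hc : Continuous fun t : ℝ => fderiv ℝ k (a + t • (b - a)) (b - a) :=
    ((hk.continuous_fderiv one_ne_zero).comp (by fun_prop)).clm_apply continuous_const
  have := intervalIntegral.integral_eq_sub_of_hasDerivAt (a := 0) (b := 1) (fun t _ => hd t)
    (hc.intervalIntegrable 0 1)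
  simp only [one_smul, add_sub_cancel, zero_smul, add_zero] at this
  rw [← this, intervalIntegral.integral_of_le zero_le_one]
  refine (enorm_integral_le_lintegral_enorm _).trans (lintegral_mono fun t => ?_)
  rw [← ofReal_norm, ← ofReal_norm, ← ofReal_norm,
    ← ENNReal.ofReal_mul (norm_nonneg _)]
  exact ENNReal.ofReal_le_ofReal (ContinuousLinearMap.le_opNorm _ _)

variable {d : ℕ}

/-- In an orthonormal basis the determinant is a polynomial in the matrix entries. -/
theorem contDiff_det_sub : ContDiff ℝ 1 fun A : Euc d →L[ℝ] Euc d =>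
    (ContinuousLinearMap.id ℝ (Euc d) - A).det := by
  have : (fun A : Euc d →L[ℝ] Euc d => (ContinuousLinearMap.id ℝ (Euc d) - A).det)
      = fun A => (Matrix.of fun i j : Fin d => ((ContinuousLinearMap.id ℝ (Euc d) - A)
          (EuclideanSpace.basisFun (Fin d) ℝ j)) i).det := by
    ext A
    rw [ContinuousLinearMap.det,
      ← LinearMap.det_toMatrix (EuclideanSpace.basisFun (Fin d) ℝ).toBasis]
    congr 1
    ext i j
    simp [LinearMap.toMatrix_apply]
  rw [this]
  simp only [Matrix.det_apply, Matrix.of_apply]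
  refine ContDiff.sum fun s _ => ContDiff.const_smul _ (contDiff_prod fun i _ => ?_)
  have h1 : ContDiff ℝ 1 fun A : Euc d →L[ℝ] Euc d => (ContinuousLinearMap.id ℝ (Euc d) - A)
      (EuclideanSpace.basisFun (Fin d) ℝ i) :=
    (contDiff_const.sub contDiff_id).clm_apply contDiff_const
  exact contDiff_euclidean.1 h1 _

/-- The mean value inequality from `0`, where the determinant is 1, on the closed ball of radius
1/2. That ball is compact in finite dimension, so the derivative is bounded there by a constant
depending only on `d`. -/
theorem exists_abs_one_sub_abs_det_le (d : ℕ) : ∃ C : ℝ≥0, ∀ A : Euc d →L[ℝ] Euc d, ‖A‖ ≤ 1 / 2 →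
    |1 - abs (ContinuousLinearMap.id ℝ (Euc d) - A).det| ≤ C * ‖A‖ := by
  have hd := contDiff_det_sub (d := d)
  obtain ⟨C, hC⟩ := (isCompact_closedBall (0 : Euc d →L[ℝ] Euc d) (1 / 2)).exists_bound_of_continuousOn
    (hd.continuous_fderiv one_ne_zero).continuousOn
  refine ⟨C.toNNReal, fun A hA => ?_⟩
  have h0 : ‖(0 : Euc d →L[ℝ] Euc d)‖ ≤ 1 / 2 := by simp
  have := (convex_closedBall (0 : Euc d →L[ℝ] Euc d) (1 / 2)).norm_image_sub_le_of_norm_fderiv_le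
    (𝕜 := ℝ) (fun B _ => hd.differentiable one_ne_zero B) hC
    (mem_closedBall_zero_iff.2 h0) (mem_closedBall_zero_iff.2 hA)
  have hdet1 : (ContinuousLinearMap.id ℝ (Euc d)).det = 1 := LinearMap.det_id
  rw [sub_zero, sub_zero, hdet1, Real.norm_eq_abs] at this
  calc _ = |abs (ContinuousLinearMap.id ℝ (Euc d) - A).det - abs 1| := by rw [abs_sub_comm, abs_one]
    _ ≤ _ := abs_abs_sub_abs_le_abs_sub _ _
    _ ≤ _ := this
    _ ≤ _ := by gcongr; exact Real.le_coe_toNNReal C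

/-! ### The change of variables `u ↦ u - τ u` -/

section Deformation

variable {τ : Euc d → Euc d}

/-- A preimage of `w` is a fixed point of the contraction `u ↦ w + τ u`. -/
theorem sub_surjective
    (hτ : ContDiff ℝ 1 τ) (hτ' : ∀ u, ‖fderiv ℝ τ u‖ ≤ 1 / 2) : Function.Surjective fun u => u - τ u := by
  intro w
  have hL : LipschitzWith (1 / 2 : ℝ≥0) τ :=
    lipschitzWith_of_nnnorm_fderiv_le (hτ.differentiable one_ne_zero) fun u => by
      rw [← NNReal.coe_le_coe]; simpa using hτ' u
  have hc : ContractingWith (1 / 2 : ℝ≥0) fun u => w + τ u :=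
    ⟨NNReal.half_lt_self one_ne_zero, LipschitzWith.of_dist_le_mul fun u v => by
      rw [dist_add_left]; exact hL.dist_le_mul u v⟩
  refine ⟨hc.fixedPoint, ?_⟩
  have : w + τ hc.fixedPoint = hc.fixedPoint := hc.fixedPoint_isFixedPt
  exact sub_eq_iff_eq_add.2 this.symm

theorem map_sub_le
    (hτ : ContDiff ℝ 1 τ) (hτ' : ∀ u, ‖fderiv ℝ τ u‖ ≤ 1 / 2) : (volume : Measure (Euc d)).map (fun u => u - τ u) ≤ (2 ^ d : ℝ≥0∞) • volume := by
  have hT : Measurable fun u => u - τ u := measurable_id.sub hτ.continuous.measurable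
  refine Measure.le_intro fun s hs _ => ?_
  rw [Measure.map_apply hT hs]
  exact volume_preimage_le (sub_antilipschitz hτ hτ') s

theorem sub_qmp
    (hτ : ContDiff ℝ 1 τ) (hτ' : ∀ u, ‖fderiv ℝ τ u‖ ≤ 1 / 2) : Measure.QuasiMeasurePreserving (fun u => u - τ u)
    (volume : Measure (Euc d)) volume :=
  ⟨measurable_id.sub hτ.continuous.measurable,
    (Measure.absolutelyContinuous_of_le (map_sub_le hτ hτ')).trans
      Measure.smul_absolutelyContinuous⟩

theorem lintegral_comp_sub_le
    (hτ : ContDiff ℝ 1 τ) (hτ' : ∀ u, ‖fderiv ℝ τ u‖ ≤ 1 / 2) {g : Euc d → ℝ≥0∞} (hg : Measurable g) :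
    ∫⁻ u, g (u - τ u) ≤ 2 ^ d * ∫⁻ u, g u := by
  rw [← lintegral_map hg (sub_qmp hτ hτ').1, ← smul_eq_mul, ← lintegral_smul_measure]
  exact lintegral_mono' (map_sub_le hτ hτ') le_rfl

/-- The map `u ↦ u - τ u` is injective, being antilipschitz, and onto, so the change of variables
covers the whole space. Nothing is required of `g`. -/
theorem integral_comp_sub_det
    (hτ : ContDiff ℝ 1 τ) (hτ' : ∀ u, ‖fderiv ℝ τ u‖ ≤ 1 / 2) {F : Type*} [NormedAddCommGroup F] [NormedSpace ℝ F]
    (g : Euc d → F) :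
    ∫ z, g z = ∫ y, |(ContinuousLinearMap.id ℝ (Euc d) - fderiv ℝ τ y).det| • g (y - τ y) := by
  have := integral_image_eq_integral_abs_det_fderiv_smul volume MeasurableSet.univ
    (f := fun u => u - τ u) (f' := fun y => ContinuousLinearMap.id ℝ (Euc d) - fderiv ℝ τ y)
    (fun y _ => ((hasFDerivAt_id y).sub
      (hτ.differentiable one_ne_zero y).hasFDerivAt).hasFDerivWithinAt)
    (sub_antilipschitz hτ hτ').injective.injOn g
  simpa [Set.image_univ, (sub_surjective hτ hτ').range_eq] using this

/-- The hypotheses on `τ` pass to `t • τ`, which makes every estimate along the segment uniform in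
`t`. -/
theorem norm_smul_fderiv_le
    (hτ : ContDiff ℝ 1 τ) (hτ' : ∀ u, ‖fderiv ℝ τ u‖ ≤ 1 / 2) {t : ℝ} (ht : t ∈ Set.Ioc (0 : ℝ) 1) (u : Euc d) :
    ‖fderiv ℝ (fun u => t • τ u) u‖ ≤ 1 / 2 := by
  rw [fderiv_fun_const_smul (hτ.differentiable one_ne_zero u), norm_smul, Real.norm_eq_abs,
    abs_of_pos ht.1]
  exact (mul_le_of_le_one_left (norm_nonneg _) ht.2).trans (hτ' u)

theorem lintegral_comp_sub_smul_le
    (hτ : ContDiff ℝ 1 τ) (hτ' : ∀ u, ‖fderiv ℝ τ u‖ ≤ 1 / 2) {g : Euc d → ℝ≥0∞} (hg : Measurable g) {t : ℝ}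
    (ht : t ∈ Set.Ioc (0 : ℝ) 1) : ∫⁻ u, g (u - t • τ u) ≤ 2 ^ d * ∫⁻ u, g u :=
  lintegral_comp_sub_le (hτ.const_smul t) (norm_smul_fderiv_le hτ hτ' ht) hg

/-- Used to trade `|y - u|`, which controls `τ y - τ u`, for the length of the point at which the
gradient of the filter is evaluated; this produces the weight `|w|` on `∇k`. -/
theorem norm_sub_le_two_mul
    (hτ : ContDiff ℝ 1 τ) (hτ' : ∀ u, ‖fderiv ℝ τ u‖ ≤ 1 / 2) {t : ℝ} (ht : t ∈ Set.Ioc (0 : ℝ) 1) (u y : Euc d) :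
    ‖y - u‖ ≤ 2 * ‖(y - t • τ y) - (u - t • τ u)‖ := by
  have := (sub_antilipschitz (hτ.const_smul t) (norm_smul_fderiv_le hτ hτ' ht)).le_mul_dist y u
  simpa [dist_eq_norm] using this

end Deformation

end

/-! ### The two `L²` estimates on `ℝ^d` -/

section

/-- Tonelli, and the fact that the interval has length 1. -/
theorem lintegral_lintegral_Ioc_le {α : Type*} [MeasurableSpace α] {μ : Measure α} [SFinite μ]
    {G : α → ℝ → ℝ≥0∞} (hG : Measurable (Function.uncurry G)) {B : ℝ≥0∞}
    (hB : ∀ t ∈ Set.Ioc (0 : ℝ) 1, ∫⁻ a, G a t ∂μ ≤ B) :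
    ∫⁻ a, (∫⁻ t in Set.Ioc (0 : ℝ) 1, G a t) ∂μ ≤ B := by
  rw [lintegral_lintegral_swap hG.aemeasurable]
  calc _ ≤ ∫⁻ _ in Set.Ioc (0 : ℝ) 1, B := setLIntegral_mono' measurableSet_Ioc hB
    _ = B := by simp

theorem lintegral_const_mul_comp_sub_right {d : ℕ} (c : ℝ≥0∞) {φ : Euc d → ℝ≥0∞}
    (hφ : Measurable φ) (a : Euc d) : ∫⁻ w, c * φ (w - a) = c * ∫⁻ w, φ w := by
  rw [lintegral_sub_right_eq_self (fun w => c * φ w), lintegral_const_mul _ hφ]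

theorem lintegral_const_mul_comp_sub_left {d : ℕ} (c : ℝ≥0∞) {φ : Euc d → ℝ≥0∞}
    (hφ : Measurable φ) (a : Euc d) : ∫⁻ w, c * φ (a - w) = c * ∫⁻ w, φ w := by
  rw [lintegral_sub_left_eq_self (fun w => c * φ w), lintegral_const_mul _ hφ]

variable {d : ℕ} {F : Type*} [NormedAddCommGroup F] [NormedSpace ℝ F]

theorem integral_smul_translate (k : Euc d → ℝ) (f : Euc d → F) (u : Euc d) :
    ∫ w, k w • f (u + w) = ∫ z, k (z - u) • f z := by
  rw [← integral_sub_right_eq_self (fun w => k w • f (u + w)) u]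
  simp

theorem integrable_smul_translate {k : Euc d → ℝ} {f : Euc d → F} {u : Euc d}
    (h : Integrable fun w => k w • f (u + w)) : Integrable fun z => k (z - u) • f z := by
  simpa using h.comp_sub_right u

/-- Needed to merge a difference of two pooled signals into one integral against a difference of
kernels. -/
theorem ae_integrable_smul_translate {k : Euc d → ℝ} (hk : Integrable k) {f : Euc d → F}
    (hf : MemLp f 2 volume) : ∀ᵐ u, Integrable fun z => k (z - u) • f z := by
  have := avg_integrable (μ := (volume : Measure (Euc d))) (π := (volume : Measure (Euc d)))
    (r := fun p : Euc d × Euc d => p.1 + p.2) (measurable_fst.add measurable_snd)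
    (fun v => measurePreserving_add_right volume v) hk hf
  filter_upwards [this] with u hu
  exact integrable_smul_translate hu

/-- The Schur test with kernel `k (z - (u - τ u)) - k (z - u)`. The row bound `hA` is a translation
in `z`; only the column bound `hB`, a substitution in `u`, pays `2 ^ d`. -/
theorem lintegral_pool_sub_pool_le {k : Euc d → ℝ} (hk : ContDiff ℝ 1 k) (hki : Integrable k)
    {τ : Euc d → Euc d} (hτ : ContDiff ℝ 1 τ) (hτ' : ∀ u, ‖fderiv ℝ τ u‖ ≤ 1 / 2)
    {s : ℝ≥0∞} (hs : ∀ u, ‖τ u‖ₑ ≤ s) {f : Euc d → F} (hf : StronglyMeasurable f)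
    (hfL : MemLp f 2 volume) :
    ∫⁻ u, ‖(∫ w, k w • f (u - τ u + w)) - ∫ w, k w • f (u + w)‖ₑ ^ 2
      ≤ 2 ^ d * (s * ∫⁻ w, ‖fderiv ℝ k w‖ₑ) ^ 2 * ∫⁻ u, ‖f u‖ₑ ^ 2 := by
  have hτc := hτ.continuous
  have hkc := hk.continuous
  have hdk : Continuous fun w => ‖fderiv ℝ k w‖ₑ := (hk.continuous_fderiv one_ne_zero).enorm
  set M := ∫⁻ w, ‖fderiv ℝ k w‖ₑ with hM
  set N : Euc d → Euc d → ℝ≥0∞ := fun u z => ‖k (z - (u - τ u)) - k (z - u)‖ₑ with hN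
  have hNm : Measurable (Function.uncurry N) := by
    refine Continuous.measurable ?_
    simp only [hN, Function.uncurry_def]
    fun_prop
  have hNb : ∀ u z, N u z ≤ ∫⁻ t in Set.Ioc (0 : ℝ) 1, s * ‖fderiv ℝ k (z - (u - t • τ u))‖ₑ := by
    intro u z
    refine (enorm_sub_le_lintegral_fderiv hk (z - u) (z - (u - τ u))).trans ?_
    refine lintegral_mono fun t => ?_
    have h1 : z - (u - τ u) - (z - u) = τ u := by abel
    have h2 : z - u + t • τ u = z - (u - t • τ u) := by abel
    dsimp only
    rw [h1, h2, mul_comm]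
    gcongr
    exact hs u
  have hA : ∀ u, ∫⁻ z, N u z ≤ s * M := fun u => by
    refine (lintegral_mono (hNb u)).trans (lintegral_lintegral_Ioc_le ?_ fun t _ => ?_)
    · refine Measurable.const_mul (Continuous.measurable ?_) _
      exact hdk.comp (by fun_prop)
    · exact (lintegral_const_mul_comp_sub_right s hdk.measurable _).le
  have hB : ∀ z, ∫⁻ u, N u z ≤ 2 ^ d * (s * M) := fun z => by
    refine (lintegral_mono fun u => hNb u z).trans (lintegral_lintegral_Ioc_le ?_ fun t ht => ?_)
    · refine Measurable.const_mul (Continuous.measurable ?_) _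
      exact hdk.comp (by fun_prop)
    · refine (lintegral_comp_sub_smul_le hτ hτ' (g := fun w => s * ‖fderiv ℝ k (z - w)‖ₑ)
        ((hdk.measurable.comp (measurable_id.const_sub _)).const_mul _) ht).trans_eq ?_
      rw [lintegral_const_mul_comp_sub_left s hdk.measurable]
  have hint := ae_integrable_smul_translate hki hfL
  calc _ ≤ ∫⁻ u, (∫⁻ z, N u z * ‖f z‖ₑ) ^ 2 := by
        refine lintegral_mono_ae ?_
        -- Integrability is needed both at `u` and at `u - τ u`; preimages of null sets under `u ↦ u
        -- - τ u` are null.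
        filter_upwards [hint, (sub_qmp hτ hτ').ae hint] with u h1 h2
        rw [integral_smul_translate, integral_smul_translate, ← integral_sub h2 h1]
        gcongr
        refine (enorm_integral_le_lintegral_enorm _).trans_eq ?_
        simp only [← sub_smul, enorm_smul, hN]
    _ ≤ s * M * (2 ^ d * (s * M)) * ∫⁻ u, ‖f u‖ₑ ^ 2 :=
        schur_lintegral_sq_le hNm hA hB hf.enorm
    _ = _ := by ring

/-- The Schur test against `f (y - τ y)`. Rows and columns obey the same bound `B`, since the point
`(y - t • τ y) - (u - t • τ u)` is antisymmetric in `u` and `y`. The outer `2 ^ d` comes from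
replacing `f (y - τ y)` by `f`. -/
theorem lintegral_pool_deform_commutator_le {C : ℝ≥0}
    (hC : ∀ A : Euc d →L[ℝ] Euc d, ‖A‖ ≤ 1 / 2 →
      |1 - abs (ContinuousLinearMap.id ℝ (Euc d) - A).det| ≤ C * ‖A‖)
    {k : Euc d → ℝ} (hk : ContDiff ℝ 1 k) (hki : Integrable k)
    {τ : Euc d → Euc d} (hτ : ContDiff ℝ 1 τ) (hτ' : ∀ u, ‖fderiv ℝ τ u‖ ≤ 1 / 2)
    {δ : ℝ≥0} (hδ : ∀ u, ‖fderiv ℝ τ u‖ ≤ δ) {f : Euc d → F} (hf : StronglyMeasurable f)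
    (hfL : MemLp f 2 volume) :
    ∫⁻ u, ‖(∫ w, k w • f (u + w - τ (u + w))) - ∫ w, k w • f (u - τ u + w)‖ₑ ^ 2
      ≤ 2 ^ d * (δ * (C * (∫⁻ w, ‖k w‖ₑ)
          + (1 + C) * (2 ^ (d + 1) * ∫⁻ w, ‖fderiv ℝ k w‖ₑ * ‖w‖ₑ))) ^ 2
        * ∫⁻ u, ‖f u‖ₑ ^ 2 := by
  have hτc := hτ.continuous
  have hkc := hk.continuous
  set φ : Euc d → ℝ≥0∞ := fun w => ‖fderiv ℝ k w‖ₑ * ‖w‖ₑ with hφ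
  have hφm : Measurable φ :=
    (hk.continuous_fderiv one_ne_zero).enorm.measurable.mul continuous_enorm.measurable
  set M₀ := ∫⁻ w, ‖k w‖ₑ with hM₀
  set M₁ := ∫⁻ w, φ w with hM₁
  set J : Euc d → ℝ := fun y => abs (ContinuousLinearMap.id ℝ (Euc d) - fderiv ℝ τ y).det with hJ
  have hJc : Continuous J :=
    (ContinuousLinearMap.continuous_det.comp
      (continuous_const.sub (hτ.continuous_fderiv one_ne_zero))).abs
  have hJ1 : ∀ y, ‖1 - J y‖ₑ ≤ C * δ := fun y => by
    rw [← ofReal_norm, ← ENNReal.coe_mul, ← ENNReal.ofReal_coe_nnreal]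
    refine ENNReal.ofReal_le_ofReal ((hC _ (hτ' y)).trans ?_)
    push_cast
    gcongr
    exact hδ y
  have hJ2 : ∀ y, ‖J y‖ₑ ≤ 1 + C := fun y => by
    have h1 := (hC _ (hτ' y)).trans (mul_le_of_le_one_right C.2 ((hτ' y).trans (by norm_num)))
    have h2 : ‖J y‖ ≤ 1 + C := by
      rw [Real.norm_eq_abs, hJ, abs_abs]
      linarith [(abs_le.1 h1).1]
    rw [← ofReal_norm]
    refine (ENNReal.ofReal_le_ofReal h2).trans_eq ?_
    rw [ENNReal.ofReal_add zero_le_one C.coe_nonneg]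
    simp
  have hL : LipschitzWith δ τ :=
    lipschitzWith_of_nnnorm_fderiv_le (hτ.differentiable one_ne_zero) fun u => hδ u
  set N : Euc d → Euc d → ℝ≥0∞ :=
    fun u y => ‖k (y - u) - J y * k (y - τ y - (u - τ u))‖ₑ with hN
  have hNm : Measurable (Function.uncurry N) := by
    refine Continuous.measurable ?_
    simp only [hN, Function.uncurry_def]
    fun_prop
  have hNb : ∀ u y, N u y ≤ C * δ * ‖k (y - u)‖ₑ + (1 + C) *
      ∫⁻ t in Set.Ioc (0 : ℝ) 1, 2 * δ * φ ((y - t • τ y) - (u - t • τ u)) := by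
    intro u y
    -- The first term measures the failure of the deformation to preserve volume, the second its
    -- failure to be a translation.
    have e1 : k (y - u) - J y * k (y - τ y - (u - τ u))
        = (1 - J y) * k (y - u) - J y * (k (y - τ y - (u - τ u)) - k (y - u)) := by ring
    refine (congrArg _ e1).trans_le ((enorm_sub_le).trans ?_)
    rw [enorm_mul, enorm_mul]
    gcongr
    · exact hJ1 y
    · exact hJ2 y
    refine (enorm_sub_le_lintegral_fderiv hk _ _).trans
      (setLIntegral_mono' measurableSet_Ioc fun t ht => ?_)
    have h1 : y - τ y - (u - τ u) - (y - u) = -(τ y - τ u) := by abel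
    have h2 : y - u + t • -(τ y - τ u) = (y - t • τ y) - (u - t • τ u) := by
      rw [smul_neg, smul_sub]; abel
    rw [h1, h2, enorm_neg, hφ]
    dsimp only
    -- Combines the Lipschitz bound `|τ y - τ u| ≤ δ |y - u|` with `norm_sub_le_two_mul`.
    have h3 : ‖τ y - τ u‖ₑ ≤ 2 * δ * ‖(y - t • τ y) - (u - t • τ u)‖ₑ := by
      have h6 : (2 * δ : ℝ≥0∞) = ENNReal.ofReal (2 * δ) := by
        rw [ENNReal.ofReal_mul zero_le_two]; simp
      rw [h6, ← ofReal_norm, ← ofReal_norm, ← ENNReal.ofReal_mul (by positivity)]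
      refine ENNReal.ofReal_le_ofReal ?_
      have h4 := hL.norm_sub_le y u
      have h5 := mul_le_mul_of_nonneg_left (norm_sub_le_two_mul hτ hτ' ht u y) δ.2
      simp only [NNReal.val_eq_coe] at h5
      linarith
    calc _ ≤ ‖fderiv ℝ k ((y - t • τ y) - (u - t • τ u))‖ₑ *
          (2 * δ * ‖(y - t • τ y) - (u - t • τ u)‖ₑ) := by gcongr
      _ = _ := by ring
  have hG : Continuous fun q : Euc d × Euc d × ℝ =>
      (q.2.1 - q.2.2 • τ q.2.1) - (q.1 - q.2.2 • τ q.1) := by fun_prop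
  have hkm : ∀ u : Euc d, Measurable fun y => ‖k (y - u)‖ₑ := fun u =>
    (hkc.measurable.comp (measurable_id.sub_const _)).enorm
  have hkm' : ∀ y : Euc d, Measurable fun u => ‖k (y - u)‖ₑ := fun u =>
    (hkc.measurable.comp (measurable_id.const_sub _)).enorm
  set B := (C * δ * M₀ + (1 + C) * (2 ^ d * (2 * δ * M₁)) : ℝ≥0∞) with hB
  have hC1 : (1 + C : ℝ≥0∞) ≠ ∞ := by simp
  have hN1 : ∀ u, ∫⁻ y, N u y ≤ B := fun u => by
    refine (lintegral_mono (hNb u)).trans ?_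
    rw [lintegral_add_left ((hkm u).const_mul _), lintegral_const_mul _ (hkm u),
      lintegral_sub_right_eq_self (fun w => ‖k w‖ₑ), lintegral_const_mul' _ _ hC1, hB]
    gcongr
    refine lintegral_lintegral_Ioc_le ?_ fun t ht => ?_
    · exact (hφm.comp (hG.measurable.comp (measurable_const.prodMk measurable_id))).const_mul _
    · refine (lintegral_comp_sub_smul_le hτ hτ'
        (g := fun w => 2 * δ * φ (w - (u - t • τ u)))
        ((hφm.comp (measurable_id.sub_const _)).const_mul _) ht).trans_eq ?_
      rw [lintegral_const_mul_comp_sub_right _ hφm]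
  have hN2 : ∀ y, ∫⁻ u, N u y ≤ B := fun y => by
    refine (lintegral_mono fun u => hNb u y).trans ?_
    rw [lintegral_add_left ((hkm' y).const_mul _), lintegral_const_mul _ (hkm' y),
      lintegral_sub_left_eq_self (fun w => ‖k w‖ₑ), lintegral_const_mul' _ _ hC1, hB]
    gcongr
    refine lintegral_lintegral_Ioc_le ?_ fun t ht => ?_
    · exact (hφm.comp (hG.measurable.comp
        (measurable_fst.prodMk (measurable_const.prodMk measurable_snd)))).const_mul _
    · refine (lintegral_comp_sub_smul_le hτ hτ'
        (g := fun w => 2 * δ * φ (y - t • τ y - w))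
        ((hφm.comp (measurable_id.const_sub _)).const_mul _) ht).trans_eq ?_
      rw [lintegral_const_mul_comp_sub_left _ hφm]
  have hTm := (sub_qmp hτ hτ').1
  have hfT : StronglyMeasurable fun y => f (y - τ y) := hf.comp_measurable hTm
  have hT2 : ∫⁻ y, ‖f (y - τ y)‖ₑ ^ 2 ≤ 2 ^ d * ∫⁻ u, ‖f u‖ₑ ^ 2 :=
    lintegral_comp_sub_le hτ hτ' (g := fun u => ‖f u‖ₑ ^ 2) (hf.enorm.pow_const 2)
  have hfTL : MemLp (fun y => f (y - τ y)) 2 volume := by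
    refine ⟨hfT.aestronglyMeasurable, ?_⟩
    refine (ENNReal.pow_lt_top_iff.1 ?_).resolve_right two_ne_zero
    rw [eLpNorm_two_sq]
    refine hT2.trans_lt (ENNReal.mul_lt_top (by simp) ?_)
    rw [← eLpNorm_two_sq]
    exact ENNReal.pow_lt_top hfL.2
  have hint := ae_integrable_smul_translate hki hfL
  have hint' := ae_integrable_smul_translate hki hfTL
  calc _ ≤ ∫⁻ u, (∫⁻ y, N u y * ‖f (y - τ y)‖ₑ) ^ 2 := by
        refine lintegral_mono_ae ?_
        filter_upwards [hint', (sub_qmp hτ hτ').ae hint] with u h1 h2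
        rw [integral_smul_translate k (fun y => f (y - τ y)), integral_smul_translate,
          integral_comp_sub_det hτ hτ' (fun z => k (z - (u - τ u)) • f z)]
        -- The integrability at `u - τ u`, transported through the same change of variables.
        have h3 : Integrable fun y =>
            J y • k (y - τ y - (u - τ u)) • f (y - τ y) := by
          have := (integrableOn_image_iff_integrableOn_abs_det_fderiv_smul volume MeasurableSet.univ
            (fun y _ => ((hasFDerivAt_id y).sub
              (hτ.differentiable one_ne_zero y).hasFDerivAt).hasFDerivWithinAt)
            (sub_antilipschitz hτ hτ').injective.injOn _).1 h2.integrableOn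
          simpa using this
        rw [← integral_sub h1 h3]
        gcongr
        refine (enorm_integral_le_lintegral_enorm _).trans_eq ?_
        simp only [← sub_smul, enorm_smul, hN, smul_smul]
    _ ≤ B * B * ∫⁻ y, ‖f (y - τ y)‖ₑ ^ 2 := schur_lintegral_sq_le hNm hN1 hN2 hfT.enorm
    _ ≤ B * B * (2 ^ d * ∫⁻ u, ‖f u‖ₑ ^ 2) := by gcongr
    _ = _ := by rw [hB]; ring

end

/-! ### The rotated, translated and dilated filter -/

section Kernel

variable {d : ℕ}

/-- The isometry and the translation preserve Lebesgue measure, and the Jacobian of the dilation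
cancels `σ ^ d`. This frees the integrals of the filter from `a`, `c` and, up to powers left
outside, `σ`. -/
theorem lintegral_dilate_isometry {g : Euc d → ℝ≥0∞} (hg : Measurable g) {σ : ℝ} (hσ : 0 < σ)
    (R : Euc d ≃ₗᵢ[ℝ] Euc d) (c : Euc d) :
    ∫⁻ w, ENNReal.ofReal (σ ^ d)⁻¹ * g (σ⁻¹ • (R.symm w - c)) = ∫⁻ w, g w := by
  have h1 : Measurable fun v : Euc d => g (σ⁻¹ • v) := hg.comp (measurable_const_smul _)
  have h2 : Measurable fun v : Euc d => g (σ⁻¹ • (v - c)) := h1.comp (measurable_id.sub_const c)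
  rw [lintegral_const_mul' _ _ ENNReal.ofReal_ne_top,
    R.symm.measurePreserving.lintegral_comp h2,
    lintegral_sub_right_eq_self (fun v => g (σ⁻¹ • v)),
    ← lintegral_map hg (measurable_const_smul _),
    Measure.map_addHaar_smul _ (inv_ne_zero hσ.ne'), lintegral_smul_measure, smul_eq_mul,
    ← mul_assoc, ← ENNReal.ofReal_mul (by positivity), finrank_euclideanSpace_fin]
  have : (σ ^ d)⁻¹ * |((σ⁻¹ ^ d)⁻¹)| = 1 := by
    rw [inv_pow, inv_inv, abs_of_pos (by positivity), inv_mul_cancel₀ (by positivity)]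
  rw [this, ENNReal.ofReal_one, one_mul]

variable {h : Euc d → ℝ} {σ : ℝ} (R : Euc d ≃ₗᵢ[ℝ] Euc d) (c : Euc d)

theorem contDiff_dilate_isometry (hh : ContDiff ℝ 1 h) :
    ContDiff ℝ 1 fun w => dilate h σ (R.symm w - c) :=
  contDiff_const.mul (hh.comp ((R.symm.contDiff.sub contDiff_const).const_smul _))

theorem integrable_dilate_isometry (hh : Integrable h) (hσ : 0 < σ) :
    Integrable fun w => dilate h σ (R.symm w - c) :=
  (R.symm.measurePreserving.integrable_comp_emb R.symm.toMeasurableEquiv.measurableEmbedding).2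
    ((dilate_integrable hh hσ).comp_sub_right c)

theorem lintegral_enorm_dilate_isometry (hh : Continuous h) (hσ : 0 < σ) :
    ∫⁻ w, ‖dilate h σ (R.symm w - c)‖ₑ = ∫⁻ w, ‖h w‖ₑ := by
  rw [← lintegral_dilate_isometry hh.enorm.measurable hσ R c]
  refine lintegral_congr fun w => ?_
  rw [dilate, enorm_mul, Real.enorm_of_nonneg (by positivity)]

theorem enorm_fderiv_dilate_isometry_le (hh : ContDiff ℝ 1 h) (hσ : 0 < σ) (w : Euc d) :
    ‖fderiv ℝ (fun w => dilate h σ (R.symm w - c)) w‖ₑ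
      ≤ ENNReal.ofReal (σ ^ d)⁻¹ *
        (ENNReal.ofReal σ⁻¹ * ‖fderiv ℝ h (σ⁻¹ • (R.symm w - c))‖ₑ) := by
  have h1 : HasFDerivAt (fun w => σ⁻¹ • (R.symm w - c))
      (σ⁻¹ • (R.symm : Euc d →L[ℝ] Euc d)) w :=
    ((R.symm : Euc d →L[ℝ] Euc d).hasFDerivAt.sub_const c).const_smul σ⁻¹
  have h2 : HasFDerivAt (fun w => dilate h σ (R.symm w - c))
      ((σ ^ d)⁻¹ • (fderiv ℝ h (σ⁻¹ • (R.symm w - c))).comp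
        (σ⁻¹ • (R.symm : Euc d →L[ℝ] Euc d))) w :=
    (((hh.differentiable one_ne_zero _).hasFDerivAt).comp w h1).const_mul _
  -- Only an inequality: the norm is 0 when `d = 0`.
  have h3 : ‖(R.symm : Euc d →L[ℝ] Euc d)‖ ≤ 1 :=
    ContinuousLinearMap.opNorm_le_bound _ zero_le_one fun v => by simp
  rw [h2.fderiv, ← ofReal_norm, ← ofReal_norm, ← ENNReal.ofReal_mul (by positivity),
    ← ENNReal.ofReal_mul (by positivity)]
  refine ENNReal.ofReal_le_ofReal ?_
  rw [norm_smul, Real.norm_of_nonneg (by positivity)]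
  gcongr
  rw [ContinuousLinearMap.comp_smul, norm_smul, Real.norm_of_nonneg (by positivity)]
  gcongr
  exact (ContinuousLinearMap.opNorm_comp_le _ _).trans (mul_le_of_le_one_right (norm_nonneg _) h3)

theorem lintegral_fderiv_dilate_isometry_le (hh : ContDiff ℝ 1 h) (hσ : 0 < σ) :
    ∫⁻ w, ‖fderiv ℝ (fun w => dilate h σ (R.symm w - c)) w‖ₑ
      ≤ ENNReal.ofReal σ⁻¹ * ∫⁻ w, ‖fderiv ℝ h w‖ₑ := by
  have hm := (hh.continuous_fderiv one_ne_zero).enorm.measurable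
  refine (lintegral_mono fun w => enorm_fderiv_dilate_isometry_le R c hh hσ w).trans_eq ?_
  rw [lintegral_dilate_isometry (g := fun v => ENNReal.ofReal σ⁻¹ * ‖fderiv ℝ h v‖ₑ)
    (hm.const_mul _) hσ, lintegral_const_mul _ hm]

/-- With `R⁻¹ w = σ v + c`, the patch condition gives `|w| / σ ≤ |v| + κ`. So the factor `σ⁻¹` from
differentiating the filter is absorbed by the weight `|w|`, and the bound no longer depends on the
scale. -/
theorem lintegral_fderiv_mul_dilate_isometry_le (hh : ContDiff ℝ 1 h) (hσ : 0 < σ) {κ : ℝ≥0}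
    (hc : ‖c‖ ≤ κ * σ) :
    ∫⁻ w, ‖fderiv ℝ (fun w => dilate h σ (R.symm w - c)) w‖ₑ * ‖w‖ₑ
      ≤ (∫⁻ w, ‖w‖ₑ * ‖fderiv ℝ h w‖ₑ) + κ * ∫⁻ w, ‖fderiv ℝ h w‖ₑ := by
  have hm : Measurable fun w => ‖fderiv ℝ h w‖ₑ :=
    (hh.continuous_fderiv one_ne_zero).enorm.measurable
  have hm' : Measurable fun w : Euc d => ‖w‖ₑ * ‖fderiv ℝ h w‖ₑ :=
    continuous_enorm.measurable.mul hm
  rw [← lintegral_const_mul _ hm, ← lintegral_add_left hm',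
    ← lintegral_dilate_isometry (g := fun w => ‖w‖ₑ * ‖fderiv ℝ h w‖ₑ + κ * ‖fderiv ℝ h w‖ₑ)
      (hm'.add (hm.const_mul _)) hσ R c]
  refine lintegral_mono fun w => ?_
  dsimp only
  set v := σ⁻¹ • (R.symm w - c) with hv
  have h1 : ENNReal.ofReal σ⁻¹ * ‖w‖ₑ ≤ ‖v‖ₑ + κ := by
    rw [← ofReal_norm, ← ofReal_norm, ← ENNReal.ofReal_coe_nnreal,
      ← ENNReal.ofReal_mul (by positivity), ← ENNReal.ofReal_add (norm_nonneg _) κ.coe_nonneg]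
    refine ENNReal.ofReal_le_ofReal ?_
    have h2 : ‖w‖ ≤ σ * ‖v‖ + κ * σ := by
      have h3 : R.symm w = σ • v + c := by
        rw [hv, smul_inv_smul₀ hσ.ne', sub_add_cancel]
      rw [← R.symm.norm_map w, h3]
      refine (norm_add_le _ _).trans ?_
      rw [norm_smul, Real.norm_of_nonneg hσ.le]
      gcongr
    rw [inv_mul_le_iff₀ hσ]
    linarith
  calc _ ≤ ENNReal.ofReal (σ ^ d)⁻¹ * (ENNReal.ofReal σ⁻¹ * ‖fderiv ℝ h v‖ₑ) * ‖w‖ₑ := by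
        gcongr
        exact enorm_fderiv_dilate_isometry_le R c hh hσ w
    _ = ENNReal.ofReal (σ ^ d)⁻¹ * (ENNReal.ofReal σ⁻¹ * ‖w‖ₑ * ‖fderiv ℝ h v‖ₑ) := by ring
    _ ≤ ENNReal.ofReal (σ ^ d)⁻¹ * ((‖v‖ₑ + κ) * ‖fderiv ℝ h v‖ₑ) := by gcongr
    _ = _ := by rw [add_mul]

end Kernel

/-! ### Estimates on the group -/

section GroupEstimates

variable {d : ℕ} {H : Type*} [Group H] [TopologicalSpace H] [MeasurableSpace H] [BorelSpace H]
  {F : Type*} [NormedAddCommGroup F] [NormedSpace ℝ F]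

theorem lintegral_semiHaar (ρ : H →* (Euc d ≃ₗᵢ[ℝ] Euc d)) (ν : Measure H) [SFinite ν]
    {φ : SemiGroup ρ → ℝ≥0∞} (hφ : Measurable φ) :
    ∫⁻ g, φ g ∂(semiHaar ρ ν) = ∫⁻ a, ∫⁻ u, φ ((coordsM ρ).symm (u, a)) ∂volume ∂ν := by
  rw [semiHaar, lintegral_map_equiv, lintegral_prod_symm']
  exact hφ.comp (coordsM ρ).symm.measurable

theorem coordsM_symm_mul_trans (ρ : H →* (Euc d ≃ₗᵢ[ℝ] Euc d)) (u v : Euc d) (a : H) :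
    (coordsM ρ).symm (u, a) * trans ρ v = (coordsM ρ).symm (u + ρ a v, a) :=
  (coords ρ).injective (by
    rw [coords_mul_trans]
    exact ((coordsM ρ).apply_symm_apply (u + ρ a v, a)).symm)

theorem deform_coordsM_symm (ρ : H →* (Euc d ≃ₗᵢ[ℝ] Euc d)) (τ : Euc d → Euc d) (u : Euc d)
    (a : H) : deform ρ τ ((coordsM ρ).symm (u, a)) = (coordsM ρ).symm (u - τ u, a) := by
  rw [deform_eq]
  simp

/-- Pooling, on functions. -/
def poolFun (ρ : H →* (Euc d ≃ₗᵢ[ℝ] Euc d)) (h : Euc d → ℝ) (σ : ℝ) (x : SemiGroup ρ → F)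
    (g : SemiGroup ρ) : F :=
  ∫ v, dilate h σ v • x (g * trans ρ v)

theorem poolFun_stronglyMeasurable {ρ : H →* (Euc d ≃ₗᵢ[ℝ] Euc d)}
    (hρ : Continuous fun p : H × Euc d => ρ p.1 p.2) {h : Euc d → ℝ} (hh : Continuous h) (σ : ℝ)
    {x : SemiGroup ρ → F} (hx : StronglyMeasurable x) :
    StronglyMeasurable (poolFun ρ h σ x) := by
  have h1 : Continuous (dilate h σ) := continuous_const.mul (hh.comp (continuous_const_smul _))
  exact ((h1.stronglyMeasurable.comp_measurable measurable_snd).smul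
    (hx.comp_measurable (mul_trans_measurable hρ))).integral_prod_right'

/-- The substitution `w = ρ(a) (v + c)` moves the rotation and the patch shift from the signal to
the filter. -/
theorem poolFun_mul_trans (ρ : H →* (Euc d ≃ₗᵢ[ℝ] Euc d)) (h : Euc d → ℝ) (σ : ℝ)
    (x : SemiGroup ρ → F) (u c : Euc d) (a : H) :
    poolFun ρ h σ x ((coordsM ρ).symm (u, a) * trans ρ c)
      = ∫ w, dilate h σ ((ρ a).symm w - c) • x ((coordsM ρ).symm (u + w, a)) := by
  rw [← (ρ a).measurePreserving.integral_comp (ρ a).toMeasurableEquiv.measurableEmbedding,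
    ← integral_add_right_eq_self _ c, poolFun]
  refine integral_congr_ae (ae_of_all _ fun v => ?_)
  simp only [coordsM_symm_mul_trans, LinearIsometryEquiv.symm_apply_apply, add_sub_cancel_right]
  rw [add_assoc, ← map_add, add_comm c v]

theorem ae_memLp_fibre (ρ : H →* (Euc d ≃ₗᵢ[ℝ] Euc d)) (ν : Measure H) [SFinite ν]
    {x : SemiGroup ρ → F} (hx : StronglyMeasurable x) (hxL : MemLp x 2 (semiHaar ρ ν)) :
    ∀ᵐ a ∂ν, MemLp (fun u => x ((coordsM ρ).symm (u, a))) 2 volume := by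
  have hm : Measurable fun g => ‖x g‖ₑ ^ 2 := hx.enorm.pow_const 2
  have hfin : ∫⁻ g, ‖x g‖ₑ ^ 2 ∂(semiHaar ρ ν) ≠ ∞ := by
    rw [← eLpNorm_two_sq]
    exact ENNReal.pow_ne_top hxL.2.ne
  rw [lintegral_semiHaar ρ ν hm] at hfin
  filter_upwards [ae_lt_top (hm.comp (coordsM ρ).symm.measurable).lintegral_prod_left' hfin]
    with a ha
  refine ⟨(hx.comp_measurable
    ((coordsM ρ).symm.measurable.comp measurable_prodMk_right)).aestronglyMeasurable, ?_⟩
  refine (ENNReal.pow_lt_top_iff.1 ?_).resolve_right two_ne_zero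
  rw [eLpNorm_two_sq]
  exact ha

/-- A bound on almost every fibre `ℝ^d × {a}` gives a bound on the group. -/
theorem lintegral_semiHaar_le_of_fibre (ρ : H →* (Euc d ≃ₗᵢ[ℝ] Euc d)) (ν : Measure H) [SFinite ν]
    {φ ψ : SemiGroup ρ → ℝ≥0∞} (hφ : Measurable φ) (hψ : Measurable ψ) {K : ℝ≥0∞}
    (h : ∀ᵐ a ∂ν, ∫⁻ u, φ ((coordsM ρ).symm (u, a)) ≤ K * ∫⁻ u, ψ ((coordsM ρ).symm (u, a))) :
    ∫⁻ g, φ g ∂(semiHaar ρ ν) ≤ K * ∫⁻ g, ψ g ∂(semiHaar ρ ν) := by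
  have hm : Measurable fun a => ∫⁻ u, ψ ((coordsM ρ).symm (u, a)) :=
    (hψ.comp (coordsM ρ).symm.measurable).lintegral_prod_left'
  rw [lintegral_semiHaar ρ ν hφ, lintegral_semiHaar ρ ν hψ, ← lintegral_const_mul _ hm]
  exact lintegral_mono_ae h

theorem lintegral_poolFun_deform_sub_le
    {ρ : H →* (Euc d ≃ₗᵢ[ℝ] Euc d)} (hρ : Continuous fun p : H × Euc d => ρ p.1 p.2)
    (ν : Measure H) [SFinite ν] {h : Euc d → ℝ} (hh : ContDiff ℝ 1 h) (hhi : Integrable h)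
    {σ : ℝ} (hσ : 0 < σ) {τ : Euc d → Euc d} (hτ : ContDiff ℝ 1 τ)
    (hτ' : ∀ u, ‖fderiv ℝ τ u‖ ≤ 1 / 2) {x : SemiGroup ρ → F} (hx : StronglyMeasurable x)
    (hxL : MemLp x 2 (semiHaar ρ ν))
    {s : ℝ≥0∞} (hs : ∀ u, ‖τ u‖ₑ ≤ s) :
    ∫⁻ g, ‖poolFun ρ h σ x (deform ρ τ g) - poolFun ρ h σ x g‖ₑ ^ 2 ∂(semiHaar ρ ν)
      ≤ 2 ^ d * (s * (ENNReal.ofReal σ⁻¹ * ∫⁻ w, ‖fderiv ℝ h w‖ₑ)) ^ 2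
        * ∫⁻ g, ‖x g‖ₑ ^ 2 ∂(semiHaar ρ ν) := by
  have hp := poolFun_stronglyMeasurable hρ hh.continuous σ hx
  refine lintegral_semiHaar_le_of_fibre ρ ν
    (φ := fun g => ‖poolFun ρ h σ x (deform ρ τ g) - poolFun ρ h σ x g‖ₑ ^ 2)
    (ψ := fun g => ‖x g‖ₑ ^ 2) (((hp.comp_measurable (deform_measurable ρ hτ)).sub hp).enorm.pow_const 2)
    (hx.enorm.pow_const 2) ?_
  filter_upwards [ae_memLp_fibre ρ ν hx hxL] with a ha
  -- Without patches, this is the case `c = 0`.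
  have h1 : ∀ u, poolFun ρ h σ x ((coordsM ρ).symm (u, a))
      = ∫ w, dilate h σ ((ρ a).symm w - 0) • x ((coordsM ρ).symm (u + w, a)) := fun u => by
    rw [← poolFun_mul_trans, coordsM_symm_mul_trans, map_zero, add_zero]
  simp only [deform_coordsM_symm, h1]
  refine (lintegral_pool_sub_pool_le (f := fun u => x ((coordsM ρ).symm (u, a)))
    (contDiff_dilate_isometry (ρ a) 0 hh)
    (integrable_dilate_isometry (ρ a) 0 hhi hσ) hτ hτ' hs (hx.comp_measurable
      ((coordsM ρ).symm.measurable.comp measurable_prodMk_right)) ha).trans ?_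
  gcongr
  exact lintegral_fderiv_dilate_isometry_le (ρ a) 0 hh hσ

/-- The bound is uniform over patch points `c` of length at most `κ σ`, as the later integration
over the patch requires. -/
theorem lintegral_poolFun_commutator_le
    {ρ : H →* (Euc d ≃ₗᵢ[ℝ] Euc d)} (hρ : Continuous fun p : H × Euc d => ρ p.1 p.2)
    (ν : Measure H) [SFinite ν] {h : Euc d → ℝ} (hh : ContDiff ℝ 1 h) (hhi : Integrable h)
    {σ : ℝ} (hσ : 0 < σ) {τ : Euc d → Euc d} (hτ : ContDiff ℝ 1 τ)
    (hτ' : ∀ u, ‖fderiv ℝ τ u‖ ≤ 1 / 2) {x : SemiGroup ρ → F} (hx : StronglyMeasurable x)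
    (hxL : MemLp x 2 (semiHaar ρ ν))
    {C : ℝ≥0}
    (hC : ∀ A : Euc d →L[ℝ] Euc d, ‖A‖ ≤ 1 / 2 →
      |1 - abs (ContinuousLinearMap.id ℝ (Euc d) - A).det| ≤ C * ‖A‖)
    {δ : ℝ≥0} (hδ : ∀ u, ‖fderiv ℝ τ u‖ ≤ δ) {κ : ℝ≥0} {c : Euc d} (hc : ‖c‖ ≤ κ * σ) :
    ∫⁻ g, ‖poolFun ρ h σ (fun g => x (deform ρ τ g)) (g * trans ρ c)
        - poolFun ρ h σ x (deform ρ τ g * trans ρ c)‖ₑ ^ 2 ∂(semiHaar ρ ν)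
      ≤ 2 ^ d * (δ * (C * (∫⁻ w, ‖h w‖ₑ) + (1 + C) * (2 ^ (d + 1) *
          ((∫⁻ w, ‖w‖ₑ * ‖fderiv ℝ h w‖ₑ) + κ * ∫⁻ w, ‖fderiv ℝ h w‖ₑ)))) ^ 2
        * ∫⁻ g, ‖x g‖ₑ ^ 2 ∂(semiHaar ρ ν) := by
  have hd := deform_measurable ρ hτ
  have ht := (mul_trans_measurePreserving hρ ν c).measurable
  have hp := poolFun_stronglyMeasurable hρ hh.continuous σ hx
  have hp' := poolFun_stronglyMeasurable hρ hh.continuous σ (hx.comp_measurable hd)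
  refine lintegral_semiHaar_le_of_fibre ρ ν
    (φ := fun g => ‖poolFun ρ h σ (fun g => x (deform ρ τ g)) (g * trans ρ c)
        - poolFun ρ h σ x (deform ρ τ g * trans ρ c)‖ₑ ^ 2) (ψ := fun g => ‖x g‖ₑ ^ 2)
    (((hp'.comp_measurable ht).sub (hp.comp_measurable (ht.comp hd))).enorm.pow_const 2)
    (hx.enorm.pow_const 2) ?_
  filter_upwards [ae_memLp_fibre ρ ν hx hxL] with a ha
  simp only [deform_coordsM_symm, poolFun_mul_trans]
  refine (lintegral_pool_deform_commutator_le (f := fun u => x ((coordsM ρ).symm (u, a)))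
    hC (contDiff_dilate_isometry (ρ a) c hh)
    (integrable_dilate_isometry (ρ a) c hhi hσ) hτ hτ' hδ (hx.comp_measurable
      ((coordsM ρ).symm.measurable.comp measurable_prodMk_right)) ha).trans ?_
  rw [lintegral_enorm_dilate_isometry (ρ a) c hh.continuous hσ]
  gcongr
  exact lintegral_fderiv_mul_dilate_isometry_le (ρ a) c hh hσ hc

end GroupEstimates


section

/-! ### Operator norm bounds -/

theorem norm_le_of_lintegral_sq_le {X Y E E' : Type*} [MeasurableSpace X] [MeasurableSpace Y]
    [NormedAddCommGroup E] [NormedAddCommGroup E'] [NormedSpace ℝ E] [NormedSpace ℝ E']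
    {μ : Measure X} {μ' : Measure Y} {x : Lp E 2 μ} {y : Lp E' 2 μ'} {K : ℝ} (hK : 0 ≤ K)
    (h : ∫⁻ b, ‖y b‖ₑ ^ 2 ∂μ' ≤ ENNReal.ofReal K ^ 2 * ∫⁻ a, ‖x a‖ₑ ^ 2 ∂μ) : ‖y‖ ≤ K * ‖x‖ := by
  rw [← eLpNorm_two_sq, ← eLpNorm_two_sq] at h
  rw [Lp.norm_def, Lp.norm_def, ← ENNReal.toReal_ofReal hK, ← ENNReal.toReal_mul]
  exact ENNReal.toReal_mono (ENNReal.mul_ne_top ENNReal.ofReal_ne_top (Lp.eLpNorm_ne_top x))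
    (le_mul_of_sq_le h)

theorem lintegral_enorm_eq_ofReal {X E : Type*} [MeasurableSpace X] [NormedAddCommGroup E]
    {μ : Measure X} {f : X → E} (hf : Integrable (fun a => ‖f a‖) μ) :
    ∫⁻ a, ‖f a‖ₑ ∂μ = ENNReal.ofReal (∫ a, ‖f a‖ ∂μ) := by
  rw [ofReal_integral_eq_lintegral_ofReal hf (ae_of_all _ fun a => norm_nonneg _)]
  simp only [ofReal_norm]

variable {d : ℕ} {H : Type*} [Group H] [TopologicalSpace H] [MeasurableSpace H] [BorelSpace H]
  {F : Type*} [NormedAddCommGroup F] [NormedSpace ℝ F]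

/-- The estimate carries the factor `2 ^ (d / 2)`; a natural number `m ≥ d / 2` avoids the
fractional exponent and serves both forms of the constant. -/
theorem norm_deformOp_comp_poolOp_sub_le {ρ : H →* (Euc d ≃ₗᵢ[ℝ] Euc d)}
    (hρ : Continuous fun p : H × Euc d => ρ p.1 p.2) (ν : Measure H) [SFinite ν]
    {h : Euc d → ℝ} (hh : ContDiff ℝ 1 h) (hhi : Integrable h)
    (hhd : Integrable fun v => ‖fderiv ℝ h v‖) {σ : ℝ} (hσ : 0 < σ)
    {τ : Euc d → Euc d} (hτ : ContDiff ℝ 1 τ) (hτ' : ∀ u, ‖fderiv ℝ τ u‖ ≤ 1 / 2)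
    (hτb : BddAbove (Set.range fun u => ‖τ u‖)) {m : ℕ} (hm : d ≤ m * 2) :
    ‖deformOp F ρ ν hτ hτ' ∘L poolOp F hρ ν hhi hσ - poolOp F hρ ν hhi hσ‖
      ≤ (2 ^ m * ∫ v, ‖fderiv ℝ h v‖) / σ * ⨆ u, ‖τ u‖ := by
  have hI : 0 ≤ ∫ v, ‖fderiv ℝ h v‖ := integral_nonneg fun v => norm_nonneg _
  have hS : 0 ≤ ⨆ u, ‖τ u‖ := Real.iSup_nonneg fun u => norm_nonneg _
  have hK : 0 ≤ (2 ^ m * ∫ v, ‖fderiv ℝ h v‖) / σ * ⨆ u, ‖τ u‖ := by positivity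
  refine ContinuousLinearMap.opNorm_le_bound _ hK fun x => norm_le_of_lintegral_sq_le hK ?_
  have h1 : poolOp F hρ ν hhi hσ x =ᵐ[semiHaar ρ ν] poolFun ρ h σ x := poolOp_ae hρ ν hhi hσ x
  have h2 : (deformOp F ρ ν hτ hτ' ∘L poolOp F hρ ν hhi hσ - poolOp F hρ ν hhi hσ) x
      =ᵐ[semiHaar ρ ν] fun g => poolFun ρ h σ x (deform ρ τ g) - poolFun ρ h σ x g := by
    filter_upwards [Lp.coeFn_sub (deformOp F ρ ν hτ hτ' (poolOp F hρ ν hhi hσ x))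
      (poolOp F hρ ν hhi hσ x), deformOp_ae ρ ν hτ hτ' (poolOp F hρ ν hhi hσ x), h1,
      (deform_qmp ρ ν hτ hτ').ae h1] with g e1 e2 e3 e4
    refine e1.trans ?_
    rw [Pi.sub_apply, e2, e3]
    exact congrArg (· - _) e4
  have h3 : ∀ u, ‖τ u‖ₑ ≤ ENNReal.ofReal (⨆ u, ‖τ u‖) := fun u => by
    rw [← ofReal_norm]
    exact ENNReal.ofReal_le_ofReal (le_ciSup hτb u)
  calc _ = ∫⁻ g, ‖poolFun ρ h σ x (deform ρ τ g) - poolFun ρ h σ x g‖ₑ ^ 2 ∂(semiHaar ρ ν) := by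
        refine lintegral_congr_ae ?_
        filter_upwards [h2] with g hg
        rw [hg]
    _ ≤ _ := lintegral_poolFun_deform_sub_le hρ ν hh hhi hσ hτ hτ' (Lp.stronglyMeasurable x)
        (Lp.memLp x) h3
    _ ≤ _ := by
        refine mul_le_mul' ?_ le_rfl
        have h4 : (2 ^ d : ℝ≥0∞) ≤ (2 ^ m) ^ 2 := by
          rw [← pow_mul]
          exact pow_le_pow_right₀ one_le_two hm
        have h5 : (2 ^ m : ℝ≥0∞) = ENNReal.ofReal (2 ^ m) := by
          rw [ENNReal.ofReal_pow zero_le_two]; simp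
        refine (mul_le_mul' h4 le_rfl).trans_eq ?_
        rw [lintegral_enorm_eq_ofReal hhd, ← mul_pow, h5, ← ENNReal.ofReal_mul (by positivity),
          ← ENNReal.ofReal_mul hS, ← ENNReal.ofReal_mul (by positivity)]
        congr 2
        field_simp

/-- The operators are given on classes, so each formula holds off a null set. Such sets are pulled
back along `(g, c) ↦ g (c, e)` and along the deformation, both quasi-measure-preserving, and then
sliced by Fubini. -/
theorem patchPoolCommutator_ae {ρ : H →* (Euc d ≃ₗᵢ[ℝ] Euc d)}
    (hρ : Continuous fun p : H × Euc d => ρ p.1 p.2) (ν : Measure H) [SFinite ν]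
    {h : Euc d → ℝ} (hhi : Integrable h) {σ : ℝ} (hσ : 0 < σ)
    {S : Set (Euc d)} (π : Measure S) [IsProbabilityMeasure π]
    {τ : Euc d → Euc d} (hτ : ContDiff ℝ 1 τ) (hτ' : ∀ u, ‖fderiv ℝ τ u‖ ≤ 1 / 2)
    (x : Lp F 2 (semiHaar ρ ν)) :
    ∀ᵐ g ∂(semiHaar ρ ν), patchPoolCommutator F hρ ν hhi hσ π hτ hτ' x g =ᵐ[π] fun c : S =>
      poolFun ρ h σ (fun g => x (deform ρ τ g)) (g * trans ρ (c : Euc d))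
        - poolFun ρ h σ x (deform ρ τ g * trans ρ (c : Euc d)) := by
  have hr : Measurable fun p : SemiGroup ρ × S => p.1 * trans ρ (p.2 : Euc d) :=
    (mul_trans_measurable hρ).comp
      (measurable_fst.prodMk (measurable_subtype_coe.comp measurable_snd))
  have hq := qmp_family (π := π) hr fun v : S => mul_trans_measurePreserving hρ ν (v : Euc d)
  have hd := deform_qmp ρ ν hτ hτ'
  have h1 : poolOp F hρ ν hhi hσ x =ᵐ[semiHaar ρ ν] poolFun ρ h σ x := poolOp_ae hρ ν hhi hσ x
  have h2 : poolOp F hρ ν hhi hσ (deformOp F ρ ν hτ hτ' x)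
      =ᵐ[semiHaar ρ ν] poolFun ρ h σ fun g => x (deform ρ τ g) :=
    (poolOp_ae hρ ν hhi hσ _).trans (avg_congr (mul_trans_measurable hρ)
      (mul_trans_measurePreserving hρ ν) (dilate h σ) (deformOp_ae ρ ν hτ hτ' x))
  have h3 := Measure.ae_ae_of_ae_prod (hq.ae h2)
  -- The order matters: slicing in `c` comes first, then the deformation acts on `g`, since here
  -- `L_τ` is applied after patch extraction.
  have h4 := hd.ae (Measure.ae_ae_of_ae_prod (hq.ae h1))
  filter_upwards [Lp.coeFn_sub
      (patchOp F hρ ν π (poolOp F hρ ν hhi hσ (deformOp F ρ ν hτ hτ' x)))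
      (deformOp (Lp F 2 π) ρ ν hτ hτ' (patchOp F hρ ν π (poolOp F hρ ν hhi hσ x))),
    patchOp_ae hρ ν π (poolOp F hρ ν hhi hσ (deformOp F ρ ν hτ hτ' x)),
    deformOp_ae ρ ν hτ hτ' (patchOp F hρ ν π (poolOp F hρ ν hhi hσ x)),
    hd.ae (patchOp_ae hρ ν π (poolOp F hρ ν hhi hσ x)), h3, h4] with g e1 e2 e3 e4 e5 e6
  have e7 : patchPoolCommutator F hρ ν hhi hσ π hτ hτ' x g
      = patchOp F hρ ν π (poolOp F hρ ν hhi hσ (deformOp F ρ ν hτ hτ' x)) g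
        - patchOp F hρ ν π (poolOp F hρ ν hhi hσ x) (deform ρ τ g) := by
    refine e1.trans ?_
    rw [Pi.sub_apply, e3]
    rfl
  rw [e7]
  filter_upwards [Lp.coeFn_sub
    (patchOp F hρ ν π (poolOp F hρ ν hhi hσ (deformOp F ρ ν hτ hτ' x)) g)
    (patchOp F hρ ν π (poolOp F hρ ν hhi hσ x) (deform ρ τ g)), e2, e4, e5, e6]
    with c f1 f2 f3 f4 f5
  rw [f1, Pi.sub_apply, f2, f3, f4, f5]

theorem commutatorConst_ofReal {C κ : ℝ≥0} {n : ℕ} {a b e : ℝ} (ha : 0 ≤ a) (hb : 0 ≤ b)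
    (he : 0 ≤ e) :
    (C * ENNReal.ofReal a + (1 + C) * (2 ^ n * (ENNReal.ofReal b + κ * ENNReal.ofReal e)) : ℝ≥0∞)
      = ENNReal.ofReal (C * a + (1 + C) * (2 ^ n * (b + κ * e))) := by
  rw [ENNReal.ofReal_add (by positivity) (by positivity), ENNReal.ofReal_mul (by positivity),
    ENNReal.ofReal_mul (by positivity), ENNReal.ofReal_mul (by positivity),
    ENNReal.ofReal_add (by positivity) (by positivity),
    ENNReal.ofReal_add (by positivity) (by positivity), ENNReal.ofReal_mul (by positivity),
    ENNReal.ofReal_pow zero_le_two]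
  simp

-- The squared norm in `L²(G, L²(π))` is an iterated integral; Tonelli puts the integral over `c`
-- outside, where the bound for fixed `c` is constant and `π` has mass 1.
set_option maxHeartbeats 1000000 in
theorem norm_patchPoolCommutator_le {C : ℝ≥0}
    (hC : ∀ A : Euc d →L[ℝ] Euc d, ‖A‖ ≤ 1 / 2 →
      |1 - abs (ContinuousLinearMap.id ℝ (Euc d) - A).det| ≤ C * ‖A‖)
    {ρ : H →* (Euc d ≃ₗᵢ[ℝ] Euc d)}
    (hρ : Continuous fun p : H × Euc d => ρ p.1 p.2) (ν : Measure H) [SFinite ν]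
    {h : Euc d → ℝ} (hh : ContDiff ℝ 1 h) (hhi : Integrable h)
    (hhd : Integrable fun v => ‖fderiv ℝ h v‖) (hhm : Integrable fun v => ‖v‖ * ‖fderiv ℝ h v‖)
    {σ : ℝ} (hσ : 0 < σ) {κ : ℝ≥0}
    {S : Set (Euc d)} (π : Measure S) [IsProbabilityMeasure π] (hS : ∀ c ∈ S, ‖c‖ ≤ κ * σ)
    {τ : Euc d → Euc d} (hτ : ContDiff ℝ 1 τ) (hτ' : ∀ u, ‖fderiv ℝ τ u‖ ≤ 1 / 2) :
    ‖patchPoolCommutator F hρ ν hhi hσ π hτ hτ'‖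
      ≤ 2 ^ d * (C * (∫ v, ‖h v‖) + (1 + C) * (2 ^ (d + 1) *
          ((∫ v, ‖v‖ * ‖fderiv ℝ h v‖) + κ * ∫ v, ‖fderiv ℝ h v‖))) * ⨆ u, ‖fderiv ℝ τ u‖ := by
  have hI₀ : 0 ≤ ∫ v, ‖h v‖ := integral_nonneg fun v => norm_nonneg _
  have hI₁ : 0 ≤ ∫ v, ‖fderiv ℝ h v‖ := integral_nonneg fun v => norm_nonneg _
  have hI₂ : 0 ≤ ∫ v, ‖v‖ * ‖fderiv ℝ h v‖ :=
    integral_nonneg fun v => mul_nonneg (norm_nonneg _) (norm_nonneg _)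
  have hT : 0 ≤ ⨆ u, ‖fderiv ℝ τ u‖ := Real.iSup_nonneg fun u => norm_nonneg _
  set B := C * (∫ v, ‖h v‖) + (1 + C) * (2 ^ (d + 1) *
          ((∫ v, ‖v‖ * ‖fderiv ℝ h v‖) + κ * ∫ v, ‖fderiv ℝ h v‖)) with hB
  have hB0 : 0 ≤ B := by positivity
  have hK : 0 ≤ 2 ^ d * B * ⨆ u, ‖fderiv ℝ τ u‖ := by positivity
  refine ContinuousLinearMap.opNorm_le_bound _ hK fun x => norm_le_of_lintegral_sq_le hK ?_
  -- Boundedness makes the real supremum a genuine upper bound rather than the default value 0.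
  have hτb : BddAbove (Set.range fun u => ‖fderiv ℝ τ u‖) :=
    ⟨1 / 2, Set.forall_mem_range.2 hτ'⟩
  have hδ : ∀ u, ‖fderiv ℝ τ u‖ ≤ (⨆ u, ‖fderiv ℝ τ u‖).toNNReal := fun u => by
    rw [Real.coe_toNNReal _ hT]
    exact le_ciSup hτb u
  have hB' : C * (∫⁻ w, ‖h w‖ₑ) + (1 + C) * (2 ^ (d + 1) *
      ((∫⁻ w, ‖w‖ₑ * ‖fderiv ℝ h w‖ₑ) + κ * ∫⁻ w, ‖fderiv ℝ h w‖ₑ)) = ENNReal.ofReal B := by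
    have e1 : ∫⁻ w, ‖w‖ₑ * ‖fderiv ℝ h w‖ₑ = ENNReal.ofReal (∫ v, ‖v‖ * ‖fderiv ℝ h v‖) := by
      rw [ofReal_integral_eq_lintegral_ofReal hhm
        (ae_of_all _ fun v => mul_nonneg (norm_nonneg _) (norm_nonneg _))]
      simp only [ENNReal.ofReal_mul (norm_nonneg _), ofReal_norm]
    rw [e1, lintegral_enorm_eq_ofReal hhi.norm, lintegral_enorm_eq_ofReal hhd,
      commutatorConst_ofReal hI₀ hI₂ hI₁]
  have hx := Lp.stronglyMeasurable x
  have hdm := deform_measurable ρ hτ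
  have hr : Measurable fun p : SemiGroup ρ × S => p.1 * trans ρ (p.2 : Euc d) :=
    (mul_trans_measurable hρ).comp
      (measurable_fst.prodMk (measurable_subtype_coe.comp measurable_snd))
  have hp := poolFun_stronglyMeasurable hρ hh.continuous σ hx
  have hp' := poolFun_stronglyMeasurable hρ hh.continuous σ (hx.comp_measurable hdm)
  set Φ : SemiGroup ρ → S → F := fun g c =>
    poolFun ρ h σ (fun g => x (deform ρ τ g)) (g * trans ρ (c : Euc d))
      - poolFun ρ h σ x (deform ρ τ g * trans ρ (c : Euc d)) with hΦ
  have hΦm : StronglyMeasurable (Function.uncurry Φ) :=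
    (hp'.comp_measurable hr).sub
      (hp.comp_measurable (hr.comp ((hdm.comp measurable_fst).prodMk measurable_snd)))
  calc _ = ∫⁻ g, ∫⁻ c, ‖Φ g c‖ₑ ^ 2 ∂π ∂(semiHaar ρ ν) := by
        refine lintegral_congr_ae ?_
        filter_upwards [patchPoolCommutator_ae hρ ν hhi hσ π hτ hτ' x] with g hg
        rw [Lp.enorm_def, eLpNorm_two_sq]
        refine lintegral_congr_ae ?_
        filter_upwards [hg] with c hc
        rw [hc]
    _ = ∫⁻ c, ∫⁻ g, ‖Φ g c‖ₑ ^ 2 ∂(semiHaar ρ ν) ∂π :=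
        lintegral_lintegral_swap (hΦm.enorm.pow_const 2).aemeasurable
    _ ≤ ∫⁻ _ : S, 2 ^ d * (ENNReal.ofReal (⨆ u, ‖fderiv ℝ τ u‖) * ENNReal.ofReal B) ^ 2
          * ∫⁻ g, ‖x g‖ₑ ^ 2 ∂(semiHaar ρ ν) ∂π := by
        refine lintegral_mono fun c => ?_
        have := lintegral_poolFun_commutator_le hρ ν hh hhi hσ hτ hτ' hx (Lp.memLp x) hC hδ
          (hS c c.2)
        rwa [hB'] at this
    _ ≤ _ := by
        rw [lintegral_const, measure_univ, mul_one]
        refine mul_le_mul' ?_ le_rfl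
        -- The factor `2 ^ (d / 2)` is relaxed to `2 ^ d`.
        have h4 : (2 ^ d : ℝ≥0∞) ≤ ENNReal.ofReal (2 ^ d) ^ 2 := by
          rw [ENNReal.ofReal_pow zero_le_two, ENNReal.ofReal_ofNat]
          exact le_self_pow₀ (one_le_pow₀ one_le_two) two_ne_zero
        refine (mul_le_mul' h4 le_rfl).trans_eq ?_
        rw [← mul_pow, ← ENNReal.ofReal_mul hT, ← ENNReal.ofReal_mul (by positivity)]
        congr 2
        ring

end

end CKN

end

/-! ### The two bounds -/

theorem mainTheorem2 (d : ℕ) :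
    -- First bound: the constant depends only on the filter `h` (hence on `d`) and on `κ`.
    (∀ (h : CKN.Euc d → ℝ) (_ : ContDiff ℝ 1 h) (hh : Integrable h volume)
      (_ : Integrable (fun v => ‖fderiv ℝ h v‖) volume) (_ : Integrable (fun v => ‖v‖ * ‖fderiv ℝ h v‖) volume)
      (κ : ℝ),
      ∃ C₁ : ℝ, 0 ≤ C₁ ∧
        ∀ (H : Type*) [Group H] [TopologicalSpace H] [IsTopologicalGroup H]
          [LocallyCompactSpace H] [MeasurableSpace H] [BorelSpace H]
          (ν : Measure H) [ν.IsHaarMeasure] [SigmaFinite ν]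
          (ρ : H →* (CKN.Euc d ≃ₗᵢ[ℝ] CKN.Euc d))
          (hρ : Continuous fun p : H × CKN.Euc d => ρ p.1 p.2)
          (F : Type*) [NormedAddCommGroup F] [InnerProductSpace ℝ F] [CompleteSpace F]
          (σ : ℝ) (hσ : 0 < σ)
          (S : Set (CKN.Euc d)) (π : Measure S) [IsProbabilityMeasure π]
          (_ : ∀ c ∈ S, ‖c‖ ≤ κ * σ)
          (τ : CKN.Euc d → CKN.Euc d) (hτ : ContDiff ℝ 1 τ) (hτ' : ∀ u, ‖fderiv ℝ τ u‖ ≤ 1 / 2),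
          ‖CKN.patchPoolCommutator F hρ ν hh hσ π hτ hτ'‖
            ≤ C₁ * ⨆ u, ‖fderiv ℝ τ u‖) ∧
    -- Second bound.
    (∀ (h : CKN.Euc d → ℝ) (_ : ContDiff ℝ 1 h) (hh : Integrable h volume)
      (_ : Integrable (fun v => ‖fderiv ℝ h v‖) volume)
      (H : Type*) [Group H] [TopologicalSpace H] [IsTopologicalGroup H]
      [LocallyCompactSpace H] [MeasurableSpace H] [BorelSpace H]
      (ν : Measure H) [ν.IsHaarMeasure] [SigmaFinite ν]
      (ρ : H →* (CKN.Euc d ≃ₗᵢ[ℝ] CKN.Euc d))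
      (hρ : Continuous fun p : H × CKN.Euc d => ρ p.1 p.2)
      (F : Type*) [NormedAddCommGroup F] [InnerProductSpace ℝ F] [CompleteSpace F]
      (σ : ℝ) (hσ : 0 < σ)
      (τ : CKN.Euc d → CKN.Euc d) (hτ : ContDiff ℝ 1 τ) (hτ' : ∀ u, ‖fderiv ℝ τ u‖ ≤ 1 / 2)
      (_ : BddAbove (Set.range fun u => ‖τ u‖)),
      (d ≤ 4 →
        ‖CKN.deformOp F ρ ν hτ hτ' ∘L CKN.poolOp F hρ ν hh hσ - CKN.poolOp F hρ ν hh hσ‖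
          ≤ (2 ^ 2 * ∫ v, ‖fderiv ℝ h v‖) / σ * ⨆ u, ‖τ u‖) ∧
      ‖CKN.deformOp F ρ ν hτ hτ' ∘L CKN.poolOp F hρ ν hh hσ - CKN.poolOp F hρ ν hh hσ‖
        ≤ (2 ^ d * ∫ v, ‖fderiv ℝ h v‖) / σ * ⨆ u, ‖τ u‖) := by
  refine ⟨fun h hh hhi hhd hhm κ => ?_, ?_⟩
  · obtain ⟨C, hC⟩ := CKN.exists_abs_one_sub_abs_det_le d
    have hI₀ : 0 ≤ ∫ v, ‖h v‖ := integral_nonneg fun v => norm_nonneg _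
    have hI₁ : 0 ≤ ∫ v, ‖fderiv ℝ h v‖ := integral_nonneg fun v => norm_nonneg _
    have hI₂ : 0 ≤ ∫ v, ‖v‖ * ‖fderiv ℝ h v‖ :=
      integral_nonneg fun v => mul_nonneg (norm_nonneg _) (norm_nonneg _)
    -- The positive part of `κ` keeps the constant nonnegative for every real `κ`; since `σ > 0`,
    -- replacing `κ` by it only weakens the patch condition.
    refine ⟨2 ^ d * (C * (∫ v, ‖h v‖) + (1 + C) * (2 ^ (d + 1) *
      ((∫ v, ‖v‖ * ‖fderiv ℝ h v‖) + κ.toNNReal * ∫ v, ‖fderiv ℝ h v‖))), by positivity, ?_⟩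
    intro H _ _ _ _ _ _ ν _ _ ρ hρ F _ _ _ σ hσ S π _ hS τ hτ hτ'
    refine CKN.norm_patchPoolCommutator_le hC hρ ν hh hhi hhd hhm hσ π (fun c hc => ?_) hτ hτ'
    exact (hS c hc).trans (mul_le_mul_of_nonneg_right (Real.le_coe_toNNReal κ) hσ.le)
  · intro h hh hhi hhd H _ _ _ _ _ _ ν _ _ ρ hρ F _ _ _ σ hσ τ hτ hτ' hτb
    -- The exponent `m = 2` is admissible exactly when `d ≤ 4`; `m = d` always is.
    exact ⟨fun hd => CKN.norm_deformOp_comp_poolOp_sub_le hρ ν hh hhi hhd hσ hτ hτ' hτb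
        (m := 2) (by omega),
      CKN.norm_deformOp_comp_poolOp_sub_le hρ ν hh hhi hhd hσ hτ hτ' hτb (m := d) (by omega)⟩
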